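/- **Setting.** Three parties, Alice (1), Bob (2) and Charlie (3), are connected by pairwise private links $12,23,31$. Alice has input $X$ and Bob has input $Y$, with $(X,Y)\sim p_{XY}$; Charlie has no input and produces an output $Z$. A protocol proceeds in rounds; in each round every party draws the bit strings it sends to the other two parties from a distribution determined by its input and the messages so far on its own two links (independently of the other parties given these), and at the end Charlie draws $Z$ from a distribution determined by the transcripts of his two links. The protocol is well-formed: it terminates with probability $1$, and every message on a link, in each direction, is a codeword of a prefix-free code determined by the messages exchanged on that link in earlier rounds. $M_{ij}$ denotes the final transcript of link $ij$ (the pair of concatenated bit strings, one for each direction) and $L_{ij}$ its total number of bits. The protocol securely computes $f$ if $Z=f(X,Y)$ with probability one and $(M_{12},M_{31})-X-(Y,Z)$, $(M_{12},M_{23})-Y-(X,Z)$, $(M_{23},M_{31})-Z-(X,Y)$ are Markov chains. All logarithms are to base 2, and $H_2(p)=-p\log p-(1-p)\log(1-p)$. With the views $V_1=(M_{12},M_{31},X)$, $V_2=(M_{12},M_{23},Y)$, $V_3=(M_{23},M_{31},Z)$, the randomness required is $\rho=\inf H(V_1,V_2,V_3\mid X,Y)$, the infimum being over all secure protocols for the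 same function and input distribution. Controlled erasure on block length $n$: $X,Y\in\{0,1\}^n$, $Z\in\{0,1,\Delta\}^n$, with $Z_i=\Delta$ if $X_i=0$ and $Z_i=Y_i$ if $X_i=1$. **Theorem.** Let $p,q\in(0,1)$, $n\ge 0$, and let $X$ consist of $n$ i.i.d. Bernoulli($p$) bits and $Y$ of $n$ i.i.d. Bernoulli($q$) bits, with a joint distribution $p_{XY}$ of full support on $\{0,1\}^n\times\{0,1\}^n$ (for instance, $X$ and $Y$ independent). 1. Every secure protocol for controlled erasure on this input distribution satisfies $$H(M_{31})\ge n(H_2(p)+p),\qquad H(M_{12})\ge n,\qquad H(M_{23})\ge n,$$ and the expected numbers of bits $\mathbb E[L_{31}],\mathbb E[L_{12}],\mathbb E[L_{23}]$ satisfy the same three lower bounds. 2. $\rho\ge n$. 3. Optimal prefix codes for $X$ (prefix codes of least expected length, such as Huffman codes) exist. For every such code $c$, consider the following protocol. Bob draws a uniform key $K\in\{0,1\}^n$ and sends $K$ to Alice and $Y\oplus K$ to Charlie; Alice then sends $c(X)$ followed by $(K_i)_{i:X_i=1}$ to Charlie, who decodes $Z$. This protocol is well-formed and secure, and it has $H(M_{31})=n(H_2(p)+p)$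 and $H(M_{12})=H(M_{23})=n=H(V_1,V_2,V_3\mid X,Y)$. Hence it is communication-ideal (each $H(M_{ij})$ equals its infimum over all secure protocols, simultaneously on all three links) and randomness-optimal ($H(V_1,V_2,V_3\mid X,Y)=\rho$). Moreover $L_{12}=L_{23}=n$ with probability one and $\mathbb E[L_{31}]<n(H_2(p)+p)+1$, so that by 1 its expected communication is optimal on the links $12$ and $23$ and within one bit of optimal on the link $31$. -/

import Mathlib

open scoped ENNReal

namespace SecureComp

/-! ### Discrete entropy, conditional entropy, Markov chains (logarithms to base 2) -/

/-- Shannon entropy, in bits, of a probability mass function (`⊤` if the series diverges). -/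
noncomputable def entropy {α : Type*} (f : α → ℝ≥0∞) : ℝ≥0∞ :=
  ∑' a, ENNReal.ofReal (Real.negMulLog (f a).toReal / Real.log 2)

/-- `H(T)` for a random variable `T` on the discrete probability space `(Ω, μ)`. -/
noncomputable def entropyOf {Ω α : Type*} (μ : PMF Ω) (T : Ω → α) : ℝ≥0∞ :=
  entropy (μ.map T)

/-- `H(T | U) = ∑ u, Pr[U = u] * H(T | U = u)`. -/
noncomputable def condEntropy {Ω α β : Type*} (μ : PMF Ω) (T : Ω → α) (U : Ω → β) : ℝ≥0∞ :=
  ∑' u, (μ.map U) u * entropy (fun t => (μ.map (fun ω => (T ω, U ω))) (t, u) / (μ.map U) u)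

/-- The Markov chain `T - U - V`: `T` and `V` are conditionally independent given `U`. -/
def MarkovChain {Ω α β γ : Type*} (μ : PMF Ω) (T : Ω → α) (U : Ω → β) (V : Ω → γ) : Prop :=
  ∀ t u v, (μ.map (fun ω => (T ω, U ω, V ω))) (t, u, v) * (μ.map U) u =
    (μ.map (fun ω => (T ω, U ω))) (t, u) * (μ.map (fun ω => (U ω, V ω))) (u, v)

/-- The binary entropy function, in bits. -/
noncomputable def binaryEntropy (p : ℝ) : ℝ := Real.binEntropy p / Real.log 2

/-! ### Three-party protocols -/

abbrev Bits := List Bool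

/-- What is sent on the three links, either in one round or in total. Each link carries one bit
string per direction: `m12 = (1 → 2, 2 → 1)`, `m23 = (2 → 3, 3 → 2)`, `m31 = (3 → 1, 1 → 3)`. -/
@[ext]
structure Links where
  m12 : Bits × Bits
  m23 : Bits × Bits
  m31 : Bits × Bits

/-- Concatenation of the messages of all rounds, separately on each link and in each direction. -/
def concat (h : List Links) : Links where
  m12 := ((h.map fun r => r.m12.1).flatten, (h.map fun r => r.m12.2).flatten)
  m23 := ((h.map fun r => r.m23.1).flatten, (h.map fun r => r.m23.2).flatten)
  m31 := ((h.map fun r => r.m31.1).flatten, (h.map fun r => r.m31.2).flatten)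

/-- A three-party protocol. In every round each party draws the messages for its two neighbours
from a distribution determined by its input and by the messages of the previous rounds on its own
two links (listed from the first round on). At the end party 3 draws its output from a
distribution determined by the final transcripts of its two links. -/
structure Protocol (X Y Z : Type) where
  /-- Party 1: input and history of the links 12 and 31; messages to 2 and to 3. -/
  next1 : X → List ((Bits × Bits) × (Bits × Bits)) → PMF (Bits × Bits)
  /-- Party 2: input and history of the links 12 and 23; messages to 1 and to 3. -/
  next2 : Y → List ((Bits × Bits) × (Bits × Bits)) → PMF (Bits × Bits)
  /-- Party 3: history of the links 23 and 31; messages to 1 and to 2. -/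
  next3 : List ((Bits × Bits) × (Bits × Bits)) → PMF (Bits × Bits)
  /-- Output of party 3, given the transcripts of the links 23 and 31. -/
  out3 : Bits × Bits → Bits × Bits → PMF Z

namespace Protocol

variable {X Y Z : Type}

/-- Law of the messages of the next round after the history `h`: the three parties draw their
messages independently of each other. -/
noncomputable def roundLaw (P : Protocol X Y Z) (x : X) (y : Y) (h : List Links) : PMF Links :=
  (P.next1 x (h.map fun r => (r.m12, r.m31))).bind fun a =>
  (P.next2 y (h.map fun r => (r.m12, r.m23))).bind fun b =>
  (P.next3 (h.map fun r => (r.m23, r.m31))).bind fun c =>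
  PMF.pure { m12 := (a.1, b.1), m23 := (b.2, c.2), m31 := (c.1, a.2) }

/-- Law of the history of the first `t` rounds on inputs `x, y`. -/
noncomputable def histLaw (P : Protocol X Y Z) (x : X) (y : Y) : ℕ → PMF (List Links)
  | 0 => PMF.pure []
  | t + 1 => (P.histLaw x y t).bind fun h => (P.roundLaw x y h).map fun r => h ++ [r]

/-- Probability that on inputs `x, y` the protocol terminates with the final transcripts `m`, i.e.
that for some `t` the transcripts after `t` rounds are `m` and no bit is sent after round `t`. By
continuity of measure this is a supremum over `t` of an infimum over the number `s` of further
rounds. -/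
noncomputable def finalMass (P : Protocol X Y Z) (x : X) (y : Y) (m : Links) : ℝ≥0∞ :=
  ⨆ t : ℕ, ⨅ s : ℕ,
    (P.histLaw x y (t + s)).toOuterMeasure {h | concat (h.take t) = m ∧ concat h = m}

/-- On inputs `x, y` the protocol terminates with probability one. -/
def Terminates (P : Protocol X Y Z) (x : X) (y : Y) : Prop :=
  ∑' m, P.finalMass x y m = 1

/-- `h` is a possible history of some initial rounds, for inputs in the support of `pXY`. -/
def Reachable (P : Protocol X Y Z) (pXY : PMF (X × Y)) (h : List Links) : Prop :=
  ∃ x y, (x, y) ∈ pXY.support ∧ h ∈ (P.histLaw x y h.length).support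

end Protocol

/-- No word of `S` is a proper prefix of another word of `S`. -/
def PrefixFree (S : Set Bits) : Prop := ∀ u ∈ S, ∀ v ∈ S, u <+: v → u = v

/-- On the link `l`, the message sent in each direction at any round is a codeword of a prefix-free
code that is determined by the messages exchanged on this link in the previous rounds. -/
def Protocol.LinkCoded {X Y Z : Type} (P : Protocol X Y Z) (pXY : PMF (X × Y))
    (l : Links → Bits × Bits) : Prop :=
  ∃ C D : List (Bits × Bits) → Set Bits, (∀ g, PrefixFree (C g) ∧ PrefixFree (D g)) ∧
    ∀ h r, P.Reachable pXY (h ++ [r]) → (l r).1 ∈ C (h.map l) ∧ (l r).2 ∈ D (h.map l)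

/-- Well-formed protocols, for inputs distributed according to `pXY`. -/
structure Protocol.WellFormed {X Y Z : Type} (P : Protocol X Y Z) (pXY : PMF (X × Y)) :
    Prop where
  coded12 : P.LinkCoded pXY Links.m12
  coded23 : P.LinkCoded pXY Links.m23
  coded31 : P.LinkCoded pXY Links.m31
  terminates : ∀ x y, (x, y) ∈ pXY.support → P.Terminates x y

/-- A well-formed protocol for inputs distributed according to `pXY`. -/
structure WFProtocol (X Y Z : Type) (pXY : PMF (X × Y)) extends Protocol X Y Z where
  wf : toProtocol.WellFormed pXY

namespace WFProtocol

variable {X Y Z : Type} {pXY : PMF (X × Y)}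

/-- Joint law of the inputs, the output and the final transcripts. -/
noncomputable def law (P : WFProtocol X Y Z pXY) : PMF (X × Y × Z × Links) :=
  ⟨fun ω => pXY (ω.1, ω.2.1) * P.finalMass ω.1 ω.2.1 ω.2.2.2 *
      P.out3 ω.2.2.2.m23 ω.2.2.2.m31 ω.2.2.1, by
    refine (ENNReal.summable.hasSum_iff).2 ?_
    rw [ENNReal.tsum_prod']
    have hxy : ∀ x y, (∑' w : Z × Links, pXY (x, y) * P.finalMass x y w.2 *
        P.out3 w.2.m23 w.2.m31 w.1) = pXY (x, y) := by
      intro x y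
      rw [ENNReal.tsum_prod', ENNReal.tsum_comm]
      simp only [ENNReal.tsum_mul_left, PMF.tsum_coe, mul_one]
      by_cases h : (x, y) ∈ pXY.support
      · rw [P.wf.terminates x y h, mul_one]
      · rw [(PMF.apply_eq_zero_iff _ _).2 h, zero_mul]
    have h2 : ∀ x, (∑' v : Y × Z × Links, pXY (x, v.1) * P.finalMass x v.1 v.2.2 *
        P.out3 v.2.2.m23 v.2.2.m31 v.2.1) = ∑' y, pXY (x, y) := by
      intro x
      rw [ENNReal.tsum_prod']
      exact tsum_congr fun y => hxy x y
    rw [tsum_congr h2, ← ENNReal.tsum_prod' (f := fun a : X × Y => pXY a)]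
    exact pXY.tsum_coe⟩

/-! The random variables of an execution, as functions on `X × Y × Z × Links`. -/

def inX (ω : X × Y × Z × Links) : X := ω.1
def inY (ω : X × Y × Z × Links) : Y := ω.2.1
def outZ (ω : X × Y × Z × Links) : Z := ω.2.2.1
def M12 (ω : X × Y × Z × Links) : Bits × Bits := ω.2.2.2.m12
def M23 (ω : X × Y × Z × Links) : Bits × Bits := ω.2.2.2.m23
def M31 (ω : X × Y × Z × Links) : Bits × Bits := ω.2.2.2.m31

/-- The views of the three parties: transcripts of their links, and their input or output. -/
def view1 (ω : X × Y × Z × Links) : ((Bits × Bits) × (Bits × Bits)) × X :=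
  ((M12 ω, M31 ω), inX ω)
def view2 (ω : X × Y × Z × Links) : ((Bits × Bits) × (Bits × Bits)) × Y :=
  ((M12 ω, M23 ω), inY ω)
def view3 (ω : X × Y × Z × Links) : ((Bits × Bits) × (Bits × Bits)) × Z :=
  ((M23 ω, M31 ω), outZ ω)

/-- Perfectly secure computation of the randomized function `pZ`, against passive corruption of at
most one party. -/
structure IsSecure (P : WFProtocol X Y Z pXY) (pZ : X → Y → PMF Z) : Prop where
  correct : ∀ x y z, (P.law.map fun ω => (inX ω, inY ω, outZ ω)) (x, y, z) =
    pXY (x, y) * pZ x y z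
  private1 : MarkovChain P.law (fun ω => (M12 ω, M31 ω)) inX (fun ω => (inY ω, outZ ω))
  private2 : MarkovChain P.law (fun ω => (M12 ω, M23 ω)) inY (fun ω => (inX ω, outZ ω))
  private3 : MarkovChain P.law (fun ω => (M23 ω, M31 ω)) outZ (fun ω => (inX ω, inY ω))

/-- `H(V₁, V₂, V₃ | X, Y)`. -/
noncomputable def randomness (P : WFProtocol X Y Z pXY) : ℝ≥0∞ :=
  condEntropy P.law (fun ω => (view1 ω, view2 ω, view3 ω)) (fun ω => (inX ω, inY ω))

end WFProtocol

/-- Number of bits in the transcript of a link, both directions together. -/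
def bitLength (m : Bits × Bits) : ℕ := m.1.length + m.2.length

/-- Expected value of an `ℕ`-valued random variable. -/
noncomputable def expectation {Ω : Type*} (μ : PMF Ω) (L : Ω → ℕ) : ℝ≥0∞ :=
  ∑' ω, μ ω * (L ω : ℝ≥0∞)

/-- `ρ(p_XY, p_Z|XY)`, the randomness required to compute `pZ` securely on inputs from `pXY`. -/
noncomputable def randomnessRequired {X Y Z : Type} (pXY : PMF (X × Y)) (pZ : X → Y → PMF Z) :
    ℝ≥0∞ :=
  ⨅ (P : WFProtocol X Y Z pXY) (_ : P.IsSecure pZ), P.randomness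

namespace WFProtocol

variable {X Y Z : Type} {pXY : PMF (X × Y)}

/-- A communication-ideal secure protocol: it achieves the least transcript entropy among all
secure protocols for the same function and input distribution, on all links simultaneously. -/
structure IsCommunicationIdeal (P : WFProtocol X Y Z pXY) (pZ : X → Y → PMF Z) : Prop where
  secure : P.IsSecure pZ
  link12 : entropyOf P.law M12 =
    ⨅ (Q : WFProtocol X Y Z pXY) (_ : Q.IsSecure pZ), entropyOf Q.law M12
  link23 : entropyOf P.law M23 =
    ⨅ (Q : WFProtocol X Y Z pXY) (_ : Q.IsSecure pZ), entropyOf Q.law M23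
  link31 : entropyOf P.law M31 =
    ⨅ (Q : WFProtocol X Y Z pXY) (_ : Q.IsSecure pZ), entropyOf Q.law M31

/-- A randomness-optimal secure protocol. -/
structure IsRandomnessOptimal (P : WFProtocol X Y Z pXY) (pZ : X → Y → PMF Z) : Prop where
  secure : P.IsSecure pZ
  optimal : P.randomness = randomnessRequired pXY pZ

end WFProtocol

/-! ### Controlled erasure -/

/-- The bits of a random string of length `n` are i.i.d. with distribution Bernoulli(`p`). -/
def IsIIDBernoulli {n : ℕ} (P : PMF (Fin n → Bool)) (p : ℝ) : Prop :=
  ∀ x, P x = ∏ i, ENNReal.ofReal (if x i then p else 1 - p)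

/-- Controlled erasure on strings of length `n`; `none` is the erasure symbol. -/
def erase {n : ℕ} (x y : Fin n → Bool) (i : Fin n) : Option Bool :=
  if x i then some (y i) else none

/-- Controlled erasure as a (deterministic) randomized function. -/
noncomputable def controlledErasure (n : ℕ) (x y : Fin n → Bool) : PMF (Fin n → Option Bool) :=
  PMF.pure (erase x y)

/-- `c` maps distinct symbols to codewords neither of which is a prefix of the other. -/
def IsPrefixCode {A : Type*} (c : A → Bits) : Prop := ∀ a b, c a <+: c b → a = b

/-- A prefix code of least expected length for the source `P`, such as a Huffman code. -/
def IsOptimalPrefixCode {A : Type*} (P : PMF A) (c : A → Bits) : Prop :=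
  IsPrefixCode c ∧ ∀ d : A → Bits, IsPrefixCode d →
    expectation P (fun a => (c a).length) ≤ expectation P (fun a => (d a).length)

/-- The bits of the string `k` at the positions `i` with `x i = 1`, in increasing order. -/
def selectBits {n : ℕ} (x : Fin n → Bool) (k : Bits) : Bits :=
  ((List.finRange n).filter fun i => x i).map fun i => k.getD i false

open Classical in
/-- Charlie's decoder: from the masked string `w = y ⊕ k` received from Bob and the string
`u = c(x) k'` received from Alice, where `k'` consists of the key bits at the positions with
`x i = 1`, he recovers `x` and unmasks these positions. -/
noncomputable def decode {n : ℕ} (c : (Fin n → Bool) → Bits) (w u : Bits) :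
    Fin n → Option Bool :=
  if h : ∃ x, c x <+: u then
    let x := h.choose
    let k' := u.drop (c x).length
    fun i => if x i then
      some (xor (w.getD i false) (k'.getD (Finset.univ.filter fun j => j < i ∧ x j).card false))
    else none
  else fun _ => none

/-- The protocol for controlled erasure, with source code `c` for Alice's input.
Round 1: Bob draws a uniform key `k` of `n` bits and sends `k` to Alice and `y ⊕ k` to Charlie.
Round 2: Alice sends `c(x)`, followed by the key bits at the positions with `x i = 1`, to Charlie.
Then Charlie decodes. -/
noncomputable def erasureProtocol (n : ℕ) (c : (Fin n → Bool) → Bits) :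
    Protocol (Fin n → Bool) (Fin n → Bool) (Fin n → Option Bool) where
  next1 x h :=
    match h with
    | [r] => PMF.pure ([], c x ++ selectBits x r.1.2)
    | _ => PMF.pure ([], [])
  next2 y h :=
    match h with
    | [] => (PMF.uniformOfFintype (Fin n → Bool)).map fun k =>
        (List.ofFn k, List.ofFn fun i => xor (y i) (k i))
    | _ => PMF.pure ([], [])
  next3 _ := PMF.pure ([], [])
  out3 m23 m31 := PMF.pure (decode c m23.1 m31.2)

end SecureComp

open SecureComp SecureComp.WFProtocol

/-! For fixed inputs `(x, y)` let `κ(x, y)` be the law of the final transcripts. Since the input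
distribution has full support, privacy says that under `κ` the pair `(M12, M31)` has a law depending
on `x` only, `(M12, M23)` on `y` only, and `(M23, M31)` on the output only. Hence the law of `M12`
is the same for all inputs. So is that of `M23`: `x` may be moved to the all-zero string, where the
output hides `y` completely, then `y` may be changed, then `x` moved back. The law of `M31` depends
on `x` only.

These are statements about `κ`, so `Y` may be redrawn from any law independent of `X`; the uniform
law gives the bounds. All of them rest on `entropy_map_le_entropy_bind_map`: if `B` is independent
of the source and `A`, `B` together determine a function of it, then `A` has at least the entropy of
that function. For `M31`, take `B = M23`: the two transcripts determine the output, whose entropy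
for uniform `Y` is `n (H₂(p) + p)`. For `M12` and `M23`, let `x` be the all-one string: the two
transcripts of party 2 determine `y`, and each is independent of `y`, so each has entropy at least
`n`. As `M12` is part of the views and has the same law given any inputs, the randomness is at least
`n` too.

That `M12`, `M23` determine `y` is a cut argument. The probability of a history is a product of one
factor per party, so two executions agreeing on both links of party 2 can exchange party 2
(`finalMass_ne_zero_of_exchange`). Prefix-freeness is needed here to recover the rounds from
concatenated transcripts. It also yields Kraft's inequality for the transcripts of a link, so that
expected length dominates entropy.

For the converse, the views in the erasure protocol can be simulated by a one-time pad argument, and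
`M31` is a function of `erase x k` for the uniform key `k`, so its entropy is at most that of the
output with uniform `Y`. An optimal prefix code exists because only finitely many codes compete with
the Shannon code, which spends less than one bit above the entropy. -/

namespace SecureComp

/-! ### Entropy of discrete distributions -/

/-- The self-information `-log t`, in bits, of an event of probability `t`. -/
noncomputable def selfInfo (t : ℝ≥0∞) : ℝ≥0∞ := ENNReal.ofReal (-Real.logb 2 t.toReal)

theorem ofReal_negMulLog_div (t : ℝ≥0∞) :
    ENNReal.ofReal (Real.negMulLog t.toReal / Real.log 2) = t.toReal.toNNReal * selfInfo t := by
  rw [selfInfo, ← ENNReal.ofReal, ← ENNReal.ofReal_mul ENNReal.toReal_nonneg]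
  congr 1
  simp only [Real.negMulLog, Real.logb]
  ring

theorem entropy_eq_tsum_mul_selfInfo {α : Type*} (f : α → ℝ≥0∞) (hf : ∀ a, f a ≠ ∞) :
    entropy f = ∑' a, f a * selfInfo (f a) := by
  refine tsum_congr fun a => ?_
  rw [ofReal_negMulLog_div, ← ENNReal.ofReal, ENNReal.ofReal_toReal (hf a)]

theorem tsum_map_mul {α β : Type*} (μ : PMF α) (T : α → β) (F : β → ℝ≥0∞) :
    ∑' b, (μ.map T) b * F b = ∑' a, μ a * F (T a) := by
  classical
  simp only [PMF.map_apply, ← ENNReal.tsum_mul_right]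
  rw [ENNReal.tsum_comm]
  refine tsum_congr fun a => ?_
  rw [tsum_eq_single (T a)]
  · simp
  · intro b hb
    simp [hb]

theorem entropy_map {α β : Type*} (μ : PMF α) (T : α → β) :
    entropy (μ.map T) = ∑' a, μ a * selfInfo ((μ.map T) (T a)) := by
  rw [entropy_eq_tsum_mul_selfInfo _ fun b => (μ.map T).apply_ne_top b, tsum_map_mul]

/-- The condition `s ≠ 0` matters: with `log 0 = 0`, an impossible event has self-information `0`,
not `∞`. -/
theorem selfInfo_anti {s t : ℝ≥0∞} (hs : s ≠ 0) (hst : s ≤ t) (ht : t ≠ ∞) :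
    selfInfo t ≤ selfInfo s := by
  have hs' : s ≠ ∞ := ne_top_of_le_ne_top ht hst
  refine ENNReal.ofReal_le_ofReal (neg_le_neg ?_)
  exact Real.logb_le_logb_of_le one_lt_two (ENNReal.toReal_pos hs hs')
    (ENNReal.toReal_mono ht hst)

theorem le_map_apply {α β : Type*} (μ : PMF α) (T : α → β) (a : α) :
    μ a ≤ (μ.map T) (T a) := by
  classical
  rw [PMF.map_apply]
  exact le_trans (by simp) (ENNReal.le_tsum a)

theorem map_apply_of_injective {α β : Type*} (μ : PMF α) {T : α → β} (hT : T.Injective) (a : α) :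
    (μ.map T) (T a) = μ a := by
  classical
  rw [PMF.map_apply, tsum_eq_single a]
  · simp
  · intro b hb
    simp [hT.ne hb.symm]

/-- Merging atoms can only raise the probability of the atom containing `a`, so self-information
drops term by term. -/
theorem entropy_map_le {α β : Type*} (μ : PMF α) (T : α → β) :
    entropy (μ.map T) ≤ entropy μ := by
  rw [entropy_map, entropy_eq_tsum_mul_selfInfo _ μ.apply_ne_top]
  refine ENNReal.tsum_le_tsum fun a => ?_
  by_cases ha : μ a = 0
  · simp [ha]
  · gcongr
    exact selfInfo_anti ha (le_map_apply μ T a) ((μ.map T).apply_ne_top _)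

theorem entropy_map_injective {α β : Type*} (μ : PMF α) {T : α → β} (hT : T.Injective) :
    entropy (μ.map T) = entropy μ := by
  rw [entropy_map, entropy_eq_tsum_mul_selfInfo _ μ.apply_ne_top]
  simp only [map_apply_of_injective μ hT]

/-- The tangent inequality for `t ↦ -t log t` at the point `s`. -/
theorem mul_selfInfo_add_le {s t : ℝ≥0∞} (hs : s ≠ 0) (hs1 : s ≤ 1) (ht1 : t ≤ 1) :
    t * selfInfo t + t * ENNReal.ofReal (1 / Real.log 2) ≤
      t * selfInfo s + s * ENNReal.ofReal (1 / Real.log 2) := by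
  by_cases ht : t = 0
  · simp [ht]
  have hst : s ≠ ∞ := ne_top_of_le_ne_top ENNReal.one_ne_top hs1
  have htt : t ≠ ∞ := ne_top_of_le_ne_top ENNReal.one_ne_top ht1
  obtain ⟨a, rfl⟩ : ∃ a : NNReal, t = a := ⟨t.toNNReal, (ENNReal.coe_toNNReal htt).symm⟩
  obtain ⟨b, rfl⟩ : ∃ b : NNReal, s = b := ⟨s.toNNReal, (ENNReal.coe_toNNReal hst).symm⟩
  have ha : (0 : ℝ) < a := by
    have : a ≠ 0 := by simpa using ht
    exact_mod_cast pos_iff_ne_zero.2 this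
  have hb : (0 : ℝ) < b := by
    have : b ≠ 0 := by simpa using hs
    exact_mod_cast pos_iff_ne_zero.2 this
  have ha1 : (a : ℝ) ≤ 1 := by exact_mod_cast ht1
  have hb1 : (b : ℝ) ≤ 1 := by exact_mod_cast hs1
  have hl2 : 0 < Real.log 2 := Real.log_pos one_lt_two
  have hIa : 0 ≤ -Real.logb 2 a := by
    have := Real.logb_nonpos one_lt_two ha.le ha1
    linarith
  have hIb : 0 ≤ -Real.logb 2 b := by
    have := Real.logb_nonpos one_lt_two hb.le hb1
    linarith
  have key : (a : ℝ) * (-Real.logb 2 a) + a * (1 / Real.log 2) ≤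
      a * (-Real.logb 2 b) + b * (1 / Real.log 2) := by
    have h1 : Real.log (b / a) ≤ b / a - 1 := Real.log_le_sub_one_of_pos (by positivity)
    rw [Real.log_div hb.ne' ha.ne'] at h1
    have h2 : a * (Real.log b - Real.log a) ≤ b - a := by
      calc (a : ℝ) * (Real.log b - Real.log a) ≤ a * (b / a - 1) := by gcongr
        _ = b - a := by field_simp
    have h3 : a * (Real.log b - Real.log a) / Real.log 2 ≤ (b - a) / Real.log 2 := by gcongr
    simp only [Real.logb]
    have e : ∀ x y : ℝ, a * (-(x / Real.log 2)) = -(a * x) / Real.log 2 := by intros; ring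
    have : a * (-(Real.log a / Real.log 2)) + a * (1 / Real.log 2)
        - (a * (-(Real.log b / Real.log 2)) + b * (1 / Real.log 2))
        = a * (Real.log b - Real.log a) / Real.log 2 - (b - a) / Real.log 2 := by ring
    linarith
  have hc : ∀ x : NNReal, (x : ℝ≥0∞) = ENNReal.ofReal x := fun x => by simp
  simp only [selfInfo, ENNReal.coe_toReal]
  rw [hc a, hc b, ← ENNReal.ofReal_mul ha.le, ← ENNReal.ofReal_mul ha.le,
    ← ENNReal.ofReal_mul ha.le, ← ENNReal.ofReal_mul hb.le,
    ← ENNReal.ofReal_add (by positivity) (by positivity),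
    ← ENNReal.ofReal_add (by positivity) (by positivity)]
  exact ENNReal.ofReal_le_ofReal key

/-- Gibbs' inequality for a sub-probability vector `r`. -/
theorem entropy_le_tsum_mul_selfInfo {α : Type*} (μ : PMF α) (r : α → ℝ≥0∞)
    (hr0 : ∀ a, μ a ≠ 0 → r a ≠ 0) (hr1 : ∑' a : μ.support, r a ≤ 1) :
    entropy μ ≤ ∑' a, μ a * selfInfo (r a) := by
  set c := ENNReal.ofReal (1 / Real.log 2)
  have hc : c ≠ ∞ := ENNReal.ofReal_ne_top
  rw [entropy_eq_tsum_mul_selfInfo _ μ.apply_ne_top]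
  -- The correction terms of the tangent inequality stay on both sides, since subtraction in `ℝ≥0∞`
  -- truncates. They total `c` on the left and at most `c` on the right, and `c` is finite, so it
  -- cancels.
  have hsum : ∑' a, μ a * selfInfo (μ a) + c ≤ ∑' a, μ a * selfInfo (r a) + c := by
    calc ∑' a, μ a * selfInfo (μ a) + c
        = ∑' a, (μ a * selfInfo (μ a) + μ a * c) := by
          rw [ENNReal.tsum_add, ENNReal.tsum_mul_right, μ.tsum_coe, one_mul]
      _ ≤ ∑' a, (μ a * selfInfo (r a) + μ.support.indicator r a * c) := by
          refine ENNReal.tsum_le_tsum fun a => ?_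
          by_cases ha : μ a = 0
          · simp [ha]
          · have hmem : a ∈ μ.support := ha
            rw [Set.indicator_of_mem hmem]
            refine mul_selfInfo_add_le (hr0 a ha) ?_ (μ.coe_le_one a)
            exact (ENNReal.le_tsum (⟨a, hmem⟩ : μ.support)).trans hr1
      _ = ∑' a, μ a * selfInfo (r a) + (∑' a : μ.support, r a) * c := by
          rw [ENNReal.tsum_add, ENNReal.tsum_mul_right, ← tsum_subtype]
      _ ≤ ∑' a, μ a * selfInfo (r a) + 1 * c := by gcongr
      _ = _ := by rw [one_mul]
  exact (ENNReal.add_le_add_iff_right hc).1 hsum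

/-- Concavity of `t ↦ t * selfInfo t`. -/
theorem tsum_mul_selfInfo_le {β : Type*} (b : PMF β) (a : β → ℝ≥0∞) (ha : ∀ x, a x ≤ 1) :
    ∑' x, b x * (a x * selfInfo (a x)) ≤
      (∑' x, b x * a x) * selfInfo (∑' x, b x * a x) := by
  set s := ∑' x, b x * a x with hs
  set c := ENNReal.ofReal (1 / Real.log 2)
  have hc : c ≠ ∞ := ENNReal.ofReal_ne_top
  have hs1 : s ≤ 1 := by
    calc s ≤ ∑' x, b x * 1 := ENNReal.tsum_le_tsum fun x => by gcongr; exact ha x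
      _ = 1 := by simp [b.tsum_coe]
  by_cases hs0 : s = 0
  · have hz : ∀ x, b x * a x = 0 := ENNReal.tsum_eq_zero.1 (hs ▸ hs0)
    simp [← mul_assoc, hz]
  have hsc : s * c ≠ ∞ := ENNReal.mul_ne_top (ne_top_of_le_ne_top ENNReal.one_ne_top hs1) hc
  refine (ENNReal.add_le_add_iff_right hsc).1 ?_
  calc ∑' x, b x * (a x * selfInfo (a x)) + s * c
      = ∑' x, b x * (a x * selfInfo (a x) + a x * c) := by
        simp only [mul_add]
        rw [ENNReal.tsum_add]
        simp only [← mul_assoc]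
        rw [ENNReal.tsum_mul_right]
    _ ≤ ∑' x, b x * (a x * selfInfo s + s * c) :=
        ENNReal.tsum_le_tsum fun x => mul_le_mul' le_rfl (mul_selfInfo_add_le hs0 hs1 (ha x))
    _ = s * selfInfo s + s * c := by
        simp only [mul_add]
        rw [ENNReal.tsum_add, ENNReal.tsum_mul_right, b.tsum_coe, one_mul]
        simp only [← mul_assoc]
        rw [ENNReal.tsum_mul_right]

/-- Concavity of entropy. -/
theorem tsum_mul_entropy_le {α β : Type*} (b : PMF β) (a : β → PMF α) :
    ∑' x, b x * entropy (a x) ≤ entropy (b.bind a) := by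
  rw [entropy_eq_tsum_mul_selfInfo _ (b.bind a).apply_ne_top]
  simp only [fun x => entropy_eq_tsum_mul_selfInfo _ (a x).apply_ne_top, PMF.bind_apply,
    ← ENNReal.tsum_mul_left]
  rw [ENNReal.tsum_comm]
  exact ENNReal.tsum_le_tsum fun t => tsum_mul_selfInfo_le b _ fun x => (a x).coe_le_one t

/-- `K x` is the conditional law of the first coordinate; at null values of the second coordinate
any law will do. -/
theorem exists_disintegration {α β : Type*} (ν : PMF (α × β)) :
    ∃ K : β → PMF α, ∀ t x, ν (t, x) = (ν.map Prod.snd) x * K x t := by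
  classical
  obtain ⟨⟨t₀, -⟩, -⟩ := ν.support_nonempty
  have hmarg : ∀ x, (ν.map Prod.snd) x = ∑' t, ν (t, x) := by
    intro x
    rw [PMF.map_apply, ENNReal.tsum_prod', ENNReal.tsum_comm, tsum_eq_single x]
    · simp
    · intro y hy
      simp [hy.symm]
  have hK : ∀ x, ∃ k : PMF α, ∀ t, ν (t, x) = (ν.map Prod.snd) x * k t := by
    intro x
    by_cases hx : (ν.map Prod.snd) x = 0
    · refine ⟨PMF.pure t₀, fun t => ?_⟩
      rw [hx, zero_mul]
      rw [hmarg] at hx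
      exact ENNReal.tsum_eq_zero.1 hx t
    · have hx' := (ν.map Prod.snd).apply_ne_top x
      refine ⟨⟨fun t => ν (t, x) / (ν.map Prod.snd) x, ?_⟩, fun t => ?_⟩
      · refine ENNReal.summable.hasSum_iff.2 ?_
        simp only [div_eq_mul_inv]
        rw [ENNReal.tsum_mul_right, ← hmarg, ENNReal.mul_inv_cancel hx hx']
      · exact (ENNReal.mul_div_cancel hx hx').symm
  choose K hK using hK
  exact ⟨K, fun t x => hK x t⟩

/-- If `B` is independent of `s`, and `A` and `B` together determine `f s`, then
`H(A) ≥ H(A | B) ≥ H(f s | B) = H(f s)`. -/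
theorem entropy_map_le_entropy_bind_map {S M α β γ : Type*} (π : PMF S) (κ : S → PMF M)
    (A : M → α) (B : M → β) (f : S → γ) (g : α → β → γ) (b : PMF β)
    (hb : ∀ s, (κ s).map B = b) (hg : ∀ s, ∀ m ∈ (κ s).support, g (A m) (B m) = f s) :
    entropy (π.map f) ≤ entropy (π.bind fun s => (κ s).map A) := by
  classical
  set ν : PMF (α × β) := π.bind fun s => (κ s).map fun m => (A m, B m) with hν
  have hfst : ν.map Prod.fst = π.bind fun s => (κ s).map A := by
    simp only [hν, PMF.map_bind, PMF.map_comp, Function.comp_def]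
  have hsnd : ν.map Prod.snd = b := by
    simp only [hν, PMF.map_bind, PMF.map_comp, Function.comp_def]
    simp only [hb, PMF.bind_const]
  obtain ⟨K, hK⟩ := exists_disintegration ν
  rw [hsnd] at hK
  have hbind : ν.map Prod.fst = b.bind K := by
    ext t
    rw [PMF.map_apply, PMF.bind_apply, ENNReal.tsum_prod', tsum_eq_single t]
    · simp [hK]
    · intro y hy
      simp [hy.symm]
  -- By independence, conditioning on `B = x` leaves `s` with law `π`, and then `f s` is read off
  -- from `A` by `g (·) x`.
  have hKg : ∀ x, b x ≠ 0 → (K x).map (g · x) = π.map f := by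
    intro x hx
    ext z
    have hx' := b.apply_ne_top x
    refine (ENNReal.mul_right_inj hx hx').1 ?_
    calc b x * ((K x).map (g · x)) z = ∑' t, ν (t, x) * (if z = g t x then 1 else 0) := by
          simp only [PMF.map_apply, hK, ← ENNReal.tsum_mul_left, mul_ite, mul_one,
            mul_zero]
      _ = ∑' w : α × β, ν w * (if w.2 = x ∧ z = g w.1 x then 1 else 0) := by
          rw [ENNReal.tsum_prod']
          refine tsum_congr fun t => ?_
          rw [tsum_eq_single x]
          · simp
          · intro y hy
            simp [hy]
      _ = ∑' s, π s * ∑' m, κ s m * (if B m = x ∧ z = g (A m) x then 1 else 0) := by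
          simp only [hν, PMF.bind_apply, ← ENNReal.tsum_mul_right]
          rw [ENNReal.tsum_comm]
          refine tsum_congr fun s => ?_
          simp only [mul_assoc]
          rw [ENNReal.tsum_mul_left, tsum_map_mul]
      _ = ∑' s, π s * ((if z = f s then 1 else 0) * b x) := by
          refine tsum_congr fun s => ?_
          congr 1
          rw [← hb s, PMF.map_apply, ← ENNReal.tsum_mul_left]
          refine tsum_congr fun m => ?_
          by_cases hm : κ s m = 0
          · simp [hm]
          · have := hg s m hm
            by_cases hB : B m = x
            · subst hB
              simp [this]
            · simp [hB, Ne.symm hB]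
      _ = b x * (π.map f) z := by
          simp only [PMF.map_apply, ← mul_assoc]
          rw [ENNReal.tsum_mul_right, mul_comm]
          simp
  calc entropy (π.map f) = ∑' x, b x * entropy (π.map f) := by
        rw [ENNReal.tsum_mul_right, b.tsum_coe, one_mul]
    _ ≤ ∑' x, b x * entropy (K x) := by
        refine ENNReal.tsum_le_tsum fun x => ?_
        by_cases hx : b x = 0
        · simp [hx]
        · gcongr
          rw [← hKg x hx]
          exact entropy_map_le _ _
    _ ≤ entropy (b.bind K) := tsum_mul_entropy_le b K
    _ = _ := by rw [← hbind, hfst]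

/-! ### Markov chains -/

theorem map_bind_map_mk_apply {S M α β : Type*} [DecidableEq β] (p : PMF S) (κ : S → PMF M)
    (T : M → α) (r : S → β) (t : α) (r₀ : β) :
    ((p.bind fun s => (κ s).map (Prod.mk s)).map fun w => (T w.2, r w.1)) (t, r₀) =
      ∑' s, p s * if r s = r₀ then ((κ s).map T) t else 0 := by
  classical
  simp only [PMF.map_bind, PMF.map_comp, PMF.bind_apply]
  refine tsum_congr fun s => ?_
  congr 1
  simp only [PMF.map_apply, Function.comp_apply, Prod.mk.injEq]
  by_cases h : r s = r₀
  · simp [h]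
  · simp [h, Ne.symm h]

theorem map_fst_bind_map_mk {S M : Type*} (p : PMF S) (κ : S → PMF M) :
    (p.bind fun s => (κ s).map (Prod.mk s)).map Prod.fst = p := by
  simp only [PMF.map_bind, PMF.map_comp]
  exact (congrArg p.bind (funext fun s => (κ s).map_const s)).trans p.bind_pure

/-- As `(u, v)` pins down `s` and `p s > 0`, conditioning on `(u s, v s)` leaves exactly `κ s`. The
Markov property identifies the resulting law of `T` with the one given `u s` alone, which `s` and
`s'` share. -/
theorem map_eq_of_markovChain {S M α β γ : Type*} (p : PMF S) (hp : ∀ s, p s ≠ 0)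
    (κ : S → PMF M) (T : M → α) (u : S → β) (v : S → γ)
    (huv : Function.Injective fun s => (u s, v s))
    (h : MarkovChain (p.bind fun s => (κ s).map (Prod.mk s)) (fun w => T w.2)
      (fun w => u w.1) fun w => v w.1) (s s' : S) (hs : u s = u s') :
    (κ s).map T = (κ s').map T := by
  classical
  set μ := p.bind fun s => (κ s).map (Prod.mk s) with hμ
  have hfst : μ.map Prod.fst = p := map_fst_bind_map_mk p κ
  have hu : (μ.map fun w => u w.1) = p.map u := by
    rw [← hfst, PMF.map_comp]; rfl
  have huv' : (μ.map fun w => (u w.1, v w.1)) = p.map fun s => (u s, v s) := by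
    conv_rhs => rw [← hfst, PMF.map_comp]
    rfl
  have key : ∀ s t, ((κ s).map T) t * (p.map u) (u s) = (μ.map fun w => (T w.2, u w.1)) (t, u s) := by
    intro s t
    have h1 := h t (u s) (v s)
    rw [hu, huv', map_apply_of_injective p huv s,
      map_bind_map_mk_apply p κ T (fun s => (u s, v s)) t, tsum_eq_single s] at h1
    · simp only [if_true] at h1
      rw [mul_assoc, mul_comm _ (p s)] at h1
      exact (ENNReal.mul_right_inj (hp s) (p.apply_ne_top s)).1 h1
    · intro s₁ hs₁
      rw [if_neg fun e => hs₁ (huv e), mul_zero]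
  ext t
  have h0 : (p.map u) (u s) ≠ 0 := fun h0 =>
    hp s (le_antisymm ((le_map_apply p u s).trans h0.le) zero_le)
  refine (ENNReal.mul_left_inj h0 ((p.map u).apply_ne_top _)).1 ?_
  rw [key s t, hs, key s' t]

/-- The converse, for proving security: `l` is a simulator that produces the law of `T` from `u`
alone. -/
theorem markovChain_of_map_eq {S M α β γ : Type*} (p : PMF S) (κ : S → PMF M) (T : M → α)
    (u : S → β) (v : S → γ) (l : β → PMF α) (h : ∀ s, (κ s).map T = l (u s)) :
    MarkovChain (p.bind fun s => (κ s).map (Prod.mk s)) (fun w => T w.2)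
      (fun w => u w.1) fun w => v w.1 := by
  classical
  set μ := p.bind fun s => (κ s).map (Prod.mk s) with hμ
  have hfst : μ.map Prod.fst = p := map_fst_bind_map_mk p κ
  have hu : (μ.map fun w => u w.1) = p.map u := by
    rw [← hfst, PMF.map_comp]; rfl
  have huv' : (μ.map fun w => (u w.1, v w.1)) = p.map fun s => (u s, v s) := by
    conv_rhs => rw [← hfst, PMF.map_comp]
    rfl
  have e1 : ∀ t u₀, (μ.map fun w => (T w.2, u w.1)) (t, u₀) = (p.map u) u₀ * l u₀ t := by
    intro t u₀
    rw [map_bind_map_mk_apply p κ T u, PMF.map_apply, ← ENNReal.tsum_mul_right]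
    refine tsum_congr fun s => ?_
    by_cases hs : u s = u₀
    · simp [hs, h]
    · simp [hs, Ne.symm hs]
  intro t u₀ v₀
  have e2 : (μ.map fun w => (T w.2, u w.1, v w.1)) (t, u₀, v₀) =
      (p.map fun s => (u s, v s)) (u₀, v₀) * l u₀ t := by
    rw [map_bind_map_mk_apply p κ T (fun s => (u s, v s)), PMF.map_apply,
      ← ENNReal.tsum_mul_right]
    refine tsum_congr fun s => ?_
    by_cases hs : (u s, v s) = (u₀, v₀)
    · have : u s = u₀ := (Prod.mk.inj hs).1
      rw [if_pos hs, if_pos hs.symm, h, this]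
    · rw [if_neg hs, if_neg (Ne.symm hs)]
      simp
  rw [hu, huv', e1, e2]
  ring

/-! ### Entropy of product distributions -/

theorem sum_prod_eq_one {S : Type*} [Fintype S] (g : S → ℝ) (hg : ∑ s, g s = 1) (n : ℕ) :
    ∑ x : Fin n → S, ∏ i, g (x i) = 1 := by
  classical
  rw [← Fintype.piFinset_univ, ← Finset.prod_univ_sum]
  simp [hg]

/-- Additivity of entropy under independence: `negMulLog` of a product splits by the Leibniz rule,
and the cofactors sum to one. -/
theorem sum_negMulLog_prod {S : Type*} [Fintype S] (g : S → ℝ) (hg : ∑ s, g s = 1) (n : ℕ) :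
    ∑ x : Fin n → S, Real.negMulLog (∏ i, g (x i)) = n * ∑ s, Real.negMulLog (g s) := by
  induction n with
  | zero => simp
  | succ n ih =>
    rw [← (Fin.consEquiv fun _ : Fin (n + 1) => S).sum_comp, Fintype.sum_prod_type]
    have h : ∀ (a : S) (x : Fin n → S),
        Real.negMulLog (∏ i, g ((Fin.consEquiv fun _ : Fin (n + 1) => S) (a, x) i)) =
          (∏ i, g (x i)) * Real.negMulLog (g a) + g a * Real.negMulLog (∏ i, g (x i)) := by
      intro a x
      rw [Fin.prod_univ_succ, Real.negMulLog_mul]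
      simp [Fin.consEquiv]
    simp only [h, Finset.sum_add_distrib, ← Finset.sum_mul, ← Finset.mul_sum, ih,
      sum_prod_eq_one g hg, hg]
    push_cast
    ring

theorem entropy_prod {S : Type*} [Fintype S] {n : ℕ} (P : PMF (Fin n → S)) (g : S → ℝ)
    (hg0 : ∀ s, 0 ≤ g s) (hg : ∑ s, g s = 1)
    (hP : ∀ x, P x = ∏ i, ENNReal.ofReal (g (x i))) :
    entropy P = ENNReal.ofReal (n * ((∑ s, Real.negMulLog (g s)) / Real.log 2)) := by
  have hlog : 0 < Real.log 2 := Real.log_pos one_lt_two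
  have hr : ∀ x, (P x).toReal = ∏ i, g (x i) := by
    intro x
    rw [hP, ← ENNReal.ofReal_prod_of_nonneg fun i _ => hg0 _, ENNReal.toReal_ofReal]
    exact Finset.prod_nonneg fun i _ => hg0 _
  rw [entropy, tsum_fintype, ← ENNReal.ofReal_sum_of_nonneg]
  · simp only [hr]
    rw [← Finset.sum_div, sum_negMulLog_prod g hg, mul_div_assoc]
  · intro x _
    refine div_nonneg (Real.negMulLog_nonneg ENNReal.toReal_nonneg ?_) hlog.le
    exact ENNReal.toReal_le_of_le_ofReal zero_le_one (by simpa using P.coe_le_one x)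

theorem entropy_of_isIIDBernoulli {n : ℕ} {P : PMF (Fin n → Bool)} {p : ℝ}
    (hp : p ∈ Set.Ioo (0 : ℝ) 1) (hP : IsIIDBernoulli P p) :
    entropy P = ENNReal.ofReal (n * binaryEntropy p) := by
  rw [entropy_prod P (fun b => if b then p else 1 - p) _ _ hP]
  · congr 2
    rw [binaryEntropy, Real.binEntropy_eq_negMulLog_add_negMulLog_one_sub]
    simp
  · rintro (_ | _)
    · simpa using hp.2.le
    · simpa using hp.1.le
  · simp

theorem uniformOfFintype_eq_prod {n : ℕ} (x : Fin n → Bool) :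
    PMF.uniformOfFintype (Fin n → Bool) x = ∏ _i : Fin n, ENNReal.ofReal (1 / 2) := by
  simp [PMF.uniformOfFintype_apply, ENNReal.inv_pow]

theorem entropy_uniformOfFintype (n : ℕ) :
    entropy (PMF.uniformOfFintype (Fin n → Bool)) = n := by
  have hlog : Real.log 2 ≠ 0 := (Real.log_pos one_lt_two).ne'
  rw [entropy_prod _ (fun _ : Bool => 1 / 2) _ _ uniformOfFintype_eq_prod]
  · have : (∑ _s : Bool, Real.negMulLog (1 / 2)) / Real.log 2 = 1 := by
      simp only [Real.negMulLog, one_div, Real.log_inv, Finset.sum_const, Finset.card_univ,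
        Fintype.card_bool, nsmul_eq_mul]
      field_simp
      simp
    rw [this, mul_one, ENNReal.ofReal_natCast]
  · intro; norm_num
  · simp

/-! ### Prefix codes -/

theorem eq_of_prefix_of_prefix {S : Set Bits} (hS : PrefixFree S) {u v w : Bits} (hu : u ∈ S)
    (hv : v ∈ S) (huw : u <+: w) (hvw : v <+: w) : u = v := by
  rcases List.prefix_or_prefix_of_prefix huw hvw with h | h
  · exact hS u hu v hv h
  · exact (hS v hv u hu h).symm

/-- The first codeword is forced, two candidates being prefixes of the same string. The empty word
is excluded because it can be repeated without trace. -/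
theorem PrefixFree.uniquelyDecodable {S : Set Bits} (hS : PrefixFree S) (h0 : [] ∉ S) :
    InformationTheory.UniquelyDecodable S := by
  intro L₁
  induction L₁ with
  | nil =>
    rintro (_ | ⟨b, L₂⟩) _ h2 h
    · rfl
    · have hb : b = [] := by
        have := h.symm
        simp only [List.flatten_nil, List.flatten_cons, List.append_eq_nil_iff] at this
        exact this.1
      exact absurd (hb ▸ h2 b (by simp)) h0
  | cons a L₁ ih =>
    rintro (_ | ⟨b, L₂⟩) h1 h2 h
    · have ha : a = [] := by
        simp only [List.flatten_nil, List.flatten_cons, List.append_eq_nil_iff] at h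
        exact h.1
      exact absurd (ha ▸ h1 a (by simp)) h0
    · simp only [List.flatten_cons] at h
      have hab : a = b := eq_of_prefix_of_prefix hS (h1 a (by simp)) (h2 b (by simp))
        (List.prefix_append a L₁.flatten) (h ▸ List.prefix_append b L₂.flatten)
      subst hab
      rw [ih L₂ (fun w hw => h1 w (by simp [hw])) (fun w hw => h2 w (by simp [hw]))
        (List.append_cancel_left h)]

/-- Kraft's inequality. -/
theorem PrefixFree.tsum_le_one {S : Set Bits} (hS : PrefixFree S) :
    ∑' w : S, (2⁻¹ : ℝ≥0∞) ^ (w : Bits).length ≤ 1 := by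
  classical
  -- A prefix-free set containing the empty word is `{[]}`. It is not uniquely decodable, so
  -- Kraft–McMillan does not cover it, but its sum is `1`.
  by_cases h0 : [] ∈ S
  · have hsub : ∀ w : S, w = ⟨[], h0⟩ := fun w =>
      Subtype.ext (hS [] h0 w w.2 List.nil_prefix).symm
    rw [tsum_eq_single ⟨[], h0⟩ fun w hw => absurd (hsub w) hw]
    simp
  · rw [ENNReal.tsum_eq_iSup_sum]
    refine iSup_le fun F => ?_
    have hF : InformationTheory.UniquelyDecodable
        ((F.map (Function.Embedding.subtype _) : Finset Bits) : Set Bits) := by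
      intro L₁ L₂ h1 h2
      refine hS.uniquelyDecodable h0 L₁ L₂ (fun w hw => ?_) fun w hw => ?_
      · obtain ⟨y, -, rfl⟩ := Finset.mem_map.1 (h1 w hw)
        exact y.2
      · obtain ⟨y, -, rfl⟩ := Finset.mem_map.1 (h2 w hw)
        exact y.2
    have := InformationTheory.kraft_mcmillan_inequality hF
    rw [Finset.sum_map] at this
    simp only [Fintype.card_bool, Function.Embedding.coe_subtype] at this
    have h2 := ENNReal.ofReal_le_ofReal this
    rw [ENNReal.ofReal_sum_of_nonneg (fun _ _ => by positivity), ENNReal.ofReal_one] at h2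
    refine le_trans (Finset.sum_le_sum fun w _ => ?_) h2
    rw [ENNReal.ofReal_pow (by positivity)]
    simp

/-- The bit strings of length `L`. -/
def bitStrings (L : ℕ) : Finset Bits := Finset.univ.map ⟨List.ofFn (n := L), List.ofFn_injective⟩

theorem card_bitStrings (L : ℕ) : (bitStrings L).card = 2 ^ L := by
  simp [bitStrings]

theorem mem_bitStrings {L : ℕ} {w : Bits} : w ∈ bitStrings L ↔ w.length = L := by
  constructor
  · intro h
    obtain ⟨f, -, rfl⟩ := Finset.mem_map.1 h
    simp
  · rintro rfl
    exact Finset.mem_map.2 ⟨w.get, Finset.mem_univ _, List.ofFn_get w⟩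

theorem card_filter_prefix_le (u : Bits) (L : ℕ) :
    ((bitStrings L).filter fun w => u <+: w).card ≤ 2 ^ (L - u.length) := by
  classical
  rw [← card_bitStrings]
  refine Finset.card_le_card_of_injOn (fun w => w.drop u.length) ?_ ?_
  · intro w hw
    have hw' := Finset.mem_filter.1 hw
    simp only [Finset.mem_coe, mem_bitStrings, List.length_drop, mem_bitStrings.1 hw'.1]
  · intro w hw w' hw' h
    obtain ⟨s, rfl⟩ := (Finset.mem_filter.1 hw).2
    obtain ⟨s', rfl⟩ := (Finset.mem_filter.1 hw').2
    simpa using h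

/-- The converse of Kraft's inequality. -/
theorem exists_prefixCode_of_sum_le_one {A : Type*} [Fintype A] (l : A → ℕ)
    (hl : ∑ a, (2⁻¹ : ℝ) ^ l a ≤ 1) :
    ∃ c : A → Bits, IsPrefixCode c ∧ ∀ a, (c a).length = l a := by
  classical
  suffices h : ∀ s : Finset A, ∑ a ∈ s, (2⁻¹ : ℝ) ^ l a ≤ 1 → ∃ c : A → Bits,
      (∀ a ∈ s, ∀ b ∈ s, c a <+: c b → a = b) ∧ ∀ a ∈ s, (c a).length = l a by
    obtain ⟨c, hc, hc'⟩ := h Finset.univ hl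
    exact ⟨c, fun a b => hc a (Finset.mem_univ a) b (Finset.mem_univ b),
      fun a => hc' a (Finset.mem_univ a)⟩
  intro s
  -- Codewords are assigned greedily by increasing length, so the new word is at least as long as
  -- all earlier ones.
  induction s using Finset.induction_on_max_value l with
  | empty => exact fun _ => ⟨fun _ => [], by simp, by simp⟩
  | insert a s ha hmax ih =>
    intro hsum
    rw [Finset.sum_insert ha] at hsum
    obtain ⟨c, hc, hlen⟩ := ih (by have : (0 : ℝ) ≤ 2⁻¹ ^ l a := by positivity
                                   linarith)
    set L := l a
    -- If every word of length `L` extended an earlier codeword, counting would make the Kraft sum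
    -- over `s` at least one and leave no room for the positive term of `a`.
    have hw : ∃ w ∈ bitStrings L, ∀ b ∈ s, ¬ c b <+: w := by
      by_contra! hcon
      have hsub : bitStrings L ⊆ s.biUnion fun b => (bitStrings L).filter fun w => c b <+: w := by
        intro w hw
        obtain ⟨b, hb, hbw⟩ := hcon w hw
        exact Finset.mem_biUnion.2 ⟨b, hb, Finset.mem_filter.2 ⟨hw, hbw⟩⟩
      have h1 : 2 ^ L ≤ ∑ b ∈ s, 2 ^ (L - l b) := by
        calc 2 ^ L = (bitStrings L).card := (card_bitStrings L).symm
          _ ≤ _ := Finset.card_le_card hsub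
          _ ≤ _ := Finset.card_biUnion_le
          _ ≤ _ := Finset.sum_le_sum fun b hb => by
            have := card_filter_prefix_le (c b) L
            rwa [hlen b hb] at this
      have h2 : (2 : ℝ) ^ L ≤ ∑ b ∈ s, (2 : ℝ) ^ L * 2⁻¹ ^ l b := by
        calc (2 : ℝ) ^ L ≤ ∑ b ∈ s, (2 : ℝ) ^ (L - l b) := by exact_mod_cast h1
          _ = _ := Finset.sum_congr rfl fun b hb => by
            rw [pow_sub₀ _ two_ne_zero (hmax b hb), inv_pow]
      rw [← Finset.mul_sum] at h2
      have h3 : (0 : ℝ) < 2 ^ L := by positivity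
      have h4 : (1 : ℝ) ≤ ∑ b ∈ s, 2⁻¹ ^ l b := by nlinarith
      have h5 : (0 : ℝ) < 2⁻¹ ^ L := by positivity
      linarith
    obtain ⟨w, hwL, hw⟩ := hw
    rw [mem_bitStrings] at hwL
    refine ⟨Function.update c a w, ?_, ?_⟩
    · intro b hb b' hb' hpre
      rcases Finset.mem_insert.1 hb with rfl | hbs <;> rcases Finset.mem_insert.1 hb' with rfl | hbs'
      · rfl
      · have hne : b' ≠ b := fun e => ha (e ▸ hbs')
        rw [Function.update_self, Function.update_of_ne hne] at hpre
        have heq : w = c b' := hpre.eq_of_length_le (by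
          rw [hlen b' hbs', hwL]; exact hmax b' hbs')
        exact absurd (heq ▸ List.prefix_rfl) (hw b' hbs')
      · have hne : b ≠ b' := fun e => ha (e ▸ hbs)
        rw [Function.update_self, Function.update_of_ne hne] at hpre
        exact absurd hpre (hw b hbs)
      · have hne : b ≠ a := fun e => ha (e ▸ hbs)
        have hne' : b' ≠ a := fun e => ha (e ▸ hbs')
        rw [Function.update_of_ne hne, Function.update_of_ne hne'] at hpre
        exact hc b hbs b' hbs' hpre
    · intro b hb
      rcases Finset.mem_insert.1 hb with rfl | hbs
      · rw [Function.update_self, hwL]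
      · have hne : b ≠ a := fun e => ha (e ▸ hbs)
        rw [Function.update_of_ne hne, hlen b hbs]

/-- The Shannon code. -/
theorem exists_prefixCode_expectation_lt {A : Type*} [Fintype A] (P : PMF A)
    (hP : ∀ a, P a ≠ 0) :
    ∃ c : A → Bits, IsPrefixCode c ∧ expectation P (fun a => (c a).length) < entropy P + 1 := by
  have hpos : ∀ a, 0 < (P a).toReal := fun a => ENNReal.toReal_pos (hP a) (P.apply_ne_top a)
  have hle : ∀ a, (P a).toReal ≤ 1 := fun a =>
    ENNReal.toReal_le_of_le_ofReal zero_le_one (by simpa using P.coe_le_one a)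
  have hsum : ∑ a, (P a).toReal = 1 := by
    have h := P.tsum_coe
    rw [tsum_fintype] at h
    rw [← ENNReal.toReal_sum fun a _ => P.apply_ne_top a, h, ENNReal.toReal_one]
  have hI : ∀ a, 0 ≤ -Real.logb 2 (P a).toReal := fun a => by
    have := Real.logb_nonpos one_lt_two (hpos a).le (hle a)
    linarith
  -- Rounding the self-informations up keeps the Kraft sum at most one and costs strictly less than
  -- one bit per symbol.
  obtain ⟨c, hc, hlen⟩ := exists_prefixCode_of_sum_le_one
    (fun a => ⌈-Real.logb 2 (P a).toReal⌉₊) (by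
      rw [← hsum]
      refine Finset.sum_le_sum fun a _ => ?_
      calc (2⁻¹ : ℝ) ^ ⌈-Real.logb 2 (P a).toReal⌉₊
          = (2 : ℝ) ^ (-(⌈-Real.logb 2 (P a).toReal⌉₊ : ℝ)) := by
            rw [Real.rpow_neg two_pos.le, Real.rpow_natCast, inv_pow]
        _ ≤ (2 : ℝ) ^ (Real.logb 2 (P a).toReal) := by
            refine Real.rpow_le_rpow_of_exponent_le one_le_two ?_
            have := Nat.le_ceil (-Real.logb 2 (P a).toReal)
            linarith
        _ = (P a).toReal := Real.rpow_logb two_pos (by norm_num) (hpos a))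
  refine ⟨c, hc, ?_⟩
  have hA : (Finset.univ : Finset A).Nonempty := by
    obtain ⟨a, -⟩ := P.support_nonempty
    exact ⟨a, Finset.mem_univ a⟩
  have hE : expectation P (fun a => (c a).length) =
      ENNReal.ofReal (∑ a, (P a).toReal * (⌈-Real.logb 2 (P a).toReal⌉₊ : ℝ)) := by
    rw [expectation, tsum_fintype,
      ENNReal.ofReal_sum_of_nonneg fun a _ => mul_nonneg (hpos a).le (Nat.cast_nonneg _)]
    refine Finset.sum_congr rfl fun a _ => ?_
    rw [ENNReal.ofReal_mul (hpos a).le, ENNReal.ofReal_toReal (P.apply_ne_top a), hlen,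
      ENNReal.ofReal_natCast]
  have hH : entropy P + 1 =
      ENNReal.ofReal (∑ a, (P a).toReal * (-Real.logb 2 (P a).toReal + 1)) := by
    have h1 : ∑ a, (P a).toReal * (-Real.logb 2 (P a).toReal + 1) =
        ∑ a, (P a).toReal * (-Real.logb 2 (P a).toReal) + 1 := by
      simp only [mul_add, mul_one, Finset.sum_add_distrib, hsum]
    rw [h1, ENNReal.ofReal_add (Finset.sum_nonneg fun a _ => mul_nonneg (hpos a).le (hI a))
      zero_le_one, ENNReal.ofReal_one, entropy_eq_tsum_mul_selfInfo _ P.apply_ne_top, tsum_fintype,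
      ENNReal.ofReal_sum_of_nonneg fun a _ => mul_nonneg (hpos a).le (hI a)]
    congr 1
    refine Finset.sum_congr rfl fun a _ => ?_
    rw [ENNReal.ofReal_mul (hpos a).le, ENNReal.ofReal_toReal (P.apply_ne_top a), selfInfo]
  have hlt : ∑ a, (P a).toReal * (⌈-Real.logb 2 (P a).toReal⌉₊ : ℝ) <
      ∑ a, (P a).toReal * (-Real.logb 2 (P a).toReal + 1) :=
    Finset.sum_lt_sum_of_nonempty hA fun a _ =>
      mul_lt_mul_of_pos_left (Nat.ceil_lt_add_one (hI a)) (hpos a)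
  rw [hE, hH]
  refine (ENNReal.ofReal_lt_ofReal_iff ?_).2 hlt
  exact lt_of_le_of_lt (Finset.sum_nonneg fun a _ =>
    mul_nonneg (hpos a).le (Nat.cast_nonneg _)) hlt

theorem IsOptimalPrefixCode.expectation_lt {A : Type*} [Fintype A] {P : PMF A}
    (hP : ∀ a, P a ≠ 0) {c : A → Bits} (hc : IsOptimalPrefixCode P c) :
    expectation P (fun a => (c a).length) < entropy P + 1 := by
  obtain ⟨d, hd, hlt⟩ := exists_prefixCode_expectation_lt P hP
  exact (hc.2 d hd).trans_lt hlt

/-- Every symbol has positive probability, so a codeword longer than `E d₀ / P a` would alone exceed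
the expected length of the Shannon code `d₀`. Hence only finitely many codes compete, and a minimum
exists. -/
theorem exists_isOptimalPrefixCode {A : Type*} [Fintype A] (P : PMF A) (hP : ∀ a, P a ≠ 0) :
    ∃ c : A → Bits, IsOptimalPrefixCode P c := by
  classical
  obtain ⟨d₀, hd₀, hlt⟩ := exists_prefixCode_expectation_lt P hP
  set E : (A → Bits) → ℝ≥0∞ := fun d => expectation P fun a => (d a).length with hE
  have hfin : E d₀ ≠ ∞ := ne_top_of_lt hlt
  have hN : ∀ a, ∃ N : ℕ, E d₀ / P a ≤ N := fun a =>
    (ENNReal.exists_nat_gt (ENNReal.div_ne_top hfin (hP a))).imp fun N h => h.le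
  choose N hN using hN
  have hset : {d : A → Bits | IsPrefixCode d ∧ E d ≤ E d₀}.Finite := by
    refine Set.Finite.subset (Set.Finite.pi' fun a =>
      List.finite_length_le Bool (N a)) ?_
    rintro d ⟨-, hd⟩ a
    have h1 : P a * ((d a).length : ℝ≥0∞) ≤ E d₀ :=
      (ENNReal.le_tsum (f := fun a => P a * ((d a).length : ℝ≥0∞)) a).trans hd
    have h2 : ((d a).length : ℝ≥0∞) ≤ E d₀ / P a := by
      rw [ENNReal.le_div_iff_mul_le (Or.inl (hP a)) (Or.inl (P.apply_ne_top a)), mul_comm]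
      exact h1
    exact_mod_cast h2.trans (hN a)
  obtain ⟨c, ⟨hc, -⟩, hmin⟩ := Set.exists_min_image _ E hset ⟨d₀, hd₀, le_rfl⟩
  refine ⟨c, hc, fun d hd => ?_⟩
  rcases le_total (E d) (E d₀) with h | h
  · exact hmin d ⟨hd, h⟩
  · exact (hmin d₀ ⟨hd₀, le_rfl⟩).trans h

/-- Gibbs' inequality against the sub-probability vector `2^(-L)`, whose self-information is `L`. -/
theorem entropy_le_expectation {α : Type*} (μ : PMF α) (L : α → ℕ)
    (hL : ∑' a : μ.support, (2⁻¹ : ℝ≥0∞) ^ L a ≤ 1) : entropy μ ≤ expectation μ L := by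
  have hI : ∀ k : ℕ, selfInfo (2⁻¹ ^ k) = k := by
    intro k
    simp only [selfInfo, ENNReal.toReal_pow, ENNReal.toReal_inv, ENNReal.toReal_ofNat,
      Real.logb_pow, Real.logb_inv]
    simp
  refine (entropy_le_tsum_mul_selfInfo μ (fun a => 2⁻¹ ^ L a) (fun a _ => ?_) hL).trans ?_
  · exact pow_ne_zero _ (by simp)
  · simp only [hI]
    exact le_rfl

/-! ### Histories of a link -/

/-- The final transcript of a link with history `g`. -/
def linkConcat (g : List (Bits × Bits)) : Bits × Bits :=
  ((g.map Prod.fst).flatten, (g.map Prod.snd).flatten)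

theorem linkConcat_append_singleton (g : List (Bits × Bits)) (r : Bits × Bits) :
    linkConcat (g ++ [r]) = ((linkConcat g).1 ++ r.1, (linkConcat g).2 ++ r.2) := by
  simp [linkConcat]

/-- The histories of `t` rounds on a link that comply with the codes `C` and `D`. -/
def codedHistories (C D : List (Bits × Bits) → Set Bits) : ℕ → Set (List (Bits × Bits))
  | 0 => {[]}
  | t + 1 => {g | ∃ g' ∈ codedHistories C D t, ∃ r : Bits × Bits,
      r.1 ∈ C g' ∧ r.2 ∈ D g' ∧ g = g' ++ [r]}

section Coded

variable {C D : List (Bits × Bits) → Set Bits}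

/-- A common extension `w` is assumed instead of equal transcripts so that the induction closes:
without their last rounds the transcripts are merely prefixes of a common string. Equal past rounds
select the same codes, and prefix-freeness then forces equal codewords. -/
theorem codedHistories_unique_of_prefix (hC : ∀ g, PrefixFree (C g) ∧ PrefixFree (D g)) {t : ℕ}
    {g g' : List (Bits × Bits)} (hg : g ∈ codedHistories C D t) (hg' : g' ∈ codedHistories C D t)
    {w : Bits × Bits} (h1 : (linkConcat g).1 <+: w.1) (h2 : (linkConcat g).2 <+: w.2)
    (h1' : (linkConcat g').1 <+: w.1) (h2' : (linkConcat g').2 <+: w.2) : g = g' := by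
  induction t generalizing g g' with
  | zero => exact (Set.mem_singleton_iff.1 hg).trans (Set.mem_singleton_iff.1 hg').symm
  | succ t ih =>
    obtain ⟨g, hg, r, hr1, hr2, rfl⟩ := hg
    obtain ⟨g', hg', r', hr1', hr2', rfl⟩ := hg'
    rw [linkConcat_append_singleton] at h1 h2 h1' h2'
    obtain rfl := ih hg hg' ((List.prefix_append _ _).trans h1) ((List.prefix_append _ _).trans h2)
      ((List.prefix_append _ _).trans h1') ((List.prefix_append _ _).trans h2')
    have e1 : r.1 = r'.1 := by
      rcases List.prefix_or_prefix_of_prefix h1 h1' with h | h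
      · exact (hC g).1 _ hr1 _ hr1' ((List.prefix_append_right_inj _).1 h)
      · exact ((hC g).1 _ hr1' _ hr1 ((List.prefix_append_right_inj _).1 h)).symm
    have e2 : r.2 = r'.2 := by
      rcases List.prefix_or_prefix_of_prefix h2 h2' with h | h
      · exact (hC g).2 _ hr2 _ hr2' ((List.prefix_append_right_inj _).1 h)
      · exact ((hC g).2 _ hr2' _ hr2 ((List.prefix_append_right_inj _).1 h)).symm
    rw [Prod.ext e1 e2]

/-- The history of a link is determined by its transcript and the number of rounds. -/
theorem codedHistories_unique (hC : ∀ g, PrefixFree (C g) ∧ PrefixFree (D g)) {t : ℕ}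
    {g g' : List (Bits × Bits)} (hg : g ∈ codedHistories C D t) (hg' : g' ∈ codedHistories C D t)
    (h : linkConcat g = linkConcat g') : g = g' :=
  codedHistories_unique_of_prefix hC hg hg' (w := linkConcat g) List.prefix_rfl List.prefix_rfl
    (h ▸ List.prefix_rfl) (h ▸ List.prefix_rfl)

/-- Kraft's inequality for the histories of a link. -/
theorem tsum_codedHistories_le_one (hC : ∀ g, PrefixFree (C g) ∧ PrefixFree (D g)) (t : ℕ) :
    ∑' g : codedHistories C D t, (2⁻¹ : ℝ≥0∞) ^ bitLength (linkConcat g) ≤ 1 := by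
  induction t with
  | zero =>
    refine (tsum_singleton (f := fun g => (2⁻¹ : ℝ≥0∞) ^ bitLength (linkConcat g)) []).trans_le ?_
    simp [linkConcat, bitLength]
  | succ t ih =>
    -- A history of `t + 1` rounds extends one of `t` rounds by a codeword in each direction, from
    -- codes fixed by that history. The sum factors accordingly, and each code contributes at most
    -- one.
    let e : (Σ g : codedHistories C D t, C g × D g) → codedHistories C D (t + 1) := fun w =>
      ⟨(w.1 : List (Bits × Bits)) ++ [((w.2.1 : Bits), (w.2.2 : Bits))], w.1, w.1.2, _,
        w.2.1.2, w.2.2.2, rfl⟩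
    have he : e.Surjective := by
      rintro ⟨_, g, hg, r, hr1, hr2, rfl⟩
      exact ⟨⟨⟨g, hg⟩, ⟨r.1, hr1⟩, ⟨r.2, hr2⟩⟩, rfl⟩
    refine (ENNReal.tsum_le_tsum_comp_of_surjective he _).trans ?_
    rw [ENNReal.tsum_sigma']
    refine le_trans (ENNReal.tsum_le_tsum fun g => ?_) ih
    have hw : ∀ w : C g × D g, (2⁻¹ : ℝ≥0∞) ^ bitLength (linkConcat (e ⟨g, w⟩)) =
        2⁻¹ ^ bitLength (linkConcat g) *
          (2⁻¹ ^ (w.1 : Bits).length * 2⁻¹ ^ (w.2 : Bits).length) := by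
      intro w
      rw [← pow_add, ← pow_add]
      congr 1
      simp only [e, linkConcat_append_singleton, bitLength, List.length_append]
      ring
    simp only [hw, ENNReal.tsum_mul_left]
    rw [ENNReal.tsum_prod']
    simp only [ENNReal.tsum_mul_left, ENNReal.tsum_mul_right]
    calc _ ≤ (2⁻¹ : ℝ≥0∞) ^ bitLength (linkConcat g) * (1 * 1) := by
          gcongr
          · exact (hC g).1.tsum_le_one
          · exact (hC g).2.tsum_le_one
      _ = _ := by rw [one_mul, mul_one]

end Coded

/-! ### The law of a history factorizes over the three parties -/

/-- Probability that a party sends its part of the messages in a history of its links; the history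
is listed from the last round on. -/
noncomputable def sendWeight {V M : Type} (next : List V → PMF M) (msg : V → M) :
    List V → ℝ≥0∞
  | [] => 1
  | v :: h => sendWeight next msg h * next h.reverse (msg v)

theorem sendWeight_le_one {V M : Type} (next : List V → PMF M) (msg : V → M) (h : List V) :
    sendWeight next msg h ≤ 1 := by
  induction h with
  | nil => exact le_rfl
  | cons v h ih => exact mul_le_one' ih (PMF.coe_le_one _ _)

namespace Protocol

variable {X Y Z : Type} (P : Protocol X Y Z)

theorem roundLaw_apply (x : X) (y : Y) (h : List Links) (r : Links) :
    P.roundLaw x y h r = P.next1 x (h.map fun r => (r.m12, r.m31)) (r.m12.1, r.m31.2) *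
      P.next2 y (h.map fun r => (r.m12, r.m23)) (r.m12.2, r.m23.1) *
      P.next3 (h.map fun r => (r.m23, r.m31)) (r.m31.1, r.m23.2) := by
  classical
  rw [roundLaw, PMF.bind_apply, tsum_eq_single (r.m12.1, r.m31.2), PMF.bind_apply,
    tsum_eq_single (r.m12.2, r.m23.1), PMF.bind_apply, tsum_eq_single (r.m31.1, r.m23.2)]
  · simp [mul_assoc]
  · rintro ⟨c, c'⟩ hc
    rw [PMF.pure_apply, if_neg, mul_zero]
    intro e
    exact hc (Prod.ext (congrArg (·.m31.1) e).symm (congrArg (·.m23.2) e).symm)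
  · rintro ⟨b, b'⟩ hb
    rw [PMF.bind_apply]
    refine mul_eq_zero_of_right _ (ENNReal.tsum_eq_zero.2 fun c => ?_)
    rw [PMF.pure_apply, if_neg, mul_zero]
    intro e
    exact hb (Prod.ext (congrArg (·.m12.2) e).symm (congrArg (·.m23.1) e).symm)
  · rintro ⟨a, a'⟩ ha
    rw [PMF.bind_apply]
    refine mul_eq_zero_of_right _ (ENNReal.tsum_eq_zero.2 fun b => mul_eq_zero_of_right _ ?_)
    rw [PMF.bind_apply]
    refine ENNReal.tsum_eq_zero.2 fun c => ?_
    rw [PMF.pure_apply, if_neg, mul_zero]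
    intro e
    exact ha (Prod.ext (congrArg (·.m12.1) e).symm (congrArg (·.m31.2) e).symm)

theorem length_of_mem_support_histLaw {x : X} {y : Y} {t : ℕ} {h : List Links}
    (hh : h ∈ (P.histLaw x y t).support) : h.length = t := by
  induction t generalizing h with
  | zero =>
    simp only [histLaw, PMF.support_pure, Set.mem_singleton_iff] at hh
    simp [hh]
  | succ t ih =>
    simp only [histLaw, PMF.mem_support_bind_iff, PMF.mem_support_map_iff] at hh
    obtain ⟨h', hh', r, -, rfl⟩ := hh
    simp [ih hh']

theorem histLaw_append (x : X) (y : Y) (t : ℕ) (h : List Links) (r : Links) :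
    P.histLaw x y (t + 1) (h ++ [r]) = P.histLaw x y t h * P.roundLaw x y h r := by
  have hinj : Function.Injective fun r : Links => h ++ [r] := fun a b hab => by simpa using hab
  rw [histLaw, PMF.bind_apply, tsum_eq_single h,
    map_apply_of_injective (P.roundLaw x y h) hinj r]
  intro h' hh'
  refine mul_eq_zero_of_right _ ((PMF.apply_eq_zero_iff _ _).2 fun hmem => ?_)
  obtain ⟨r', -, hr'⟩ := (PMF.mem_support_map_iff _ _ _).1 hmem
  exact hh' (List.append_inj_left' hr' rfl)

/-- Probability that party 1 sends its part of the messages in the history `h`. -/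
noncomputable def weight1 (x : X) (h : List (Bits × Bits)) (h' : List (Bits × Bits)) : ℝ≥0∞ :=
  sendWeight (P.next1 x) (fun v => (v.1.1, v.2.2)) (h.zip h').reverse

/-- Probability that party 2 sends its part of the messages in the history `h`. -/
noncomputable def weight2 (y : Y) (h : List (Bits × Bits)) (h' : List (Bits × Bits)) : ℝ≥0∞ :=
  sendWeight (P.next2 y) (fun v => (v.1.2, v.2.1)) (h.zip h').reverse

/-- Probability that party 3 sends its part of the messages in the history `h`. -/
noncomputable def weight3 (h : List (Bits × Bits)) (h' : List (Bits × Bits)) : ℝ≥0∞ :=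
  sendWeight P.next3 (fun v => (v.2.1, v.1.2)) (h.zip h').reverse

/-- Each factor sees only its party's input and two links. This is what allows party 2 to be
exchanged while links 12 and 23 are held fixed. -/
theorem histLaw_eq_mul (x : X) (y : Y) (h : List Links) :
    P.histLaw x y h.length h = P.weight1 x (h.map Links.m12) (h.map Links.m31) *
      P.weight2 y (h.map Links.m12) (h.map Links.m23) *
      P.weight3 (h.map Links.m23) (h.map Links.m31) := by
  simp only [weight1, weight2, weight3, List.zip_map']
  induction h using List.reverseRecOn with
  | nil => simp [histLaw, sendWeight]
  | append_singleton h r ih =>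
    rw [List.length_append, List.length_singleton, histLaw_append, ih, roundLaw_apply]
    simp only [List.map_append, List.map_cons, List.map_nil, List.reverse_append,
      List.reverse_singleton, List.singleton_append, sendWeight, List.reverse_reverse]
    ring

theorem Reachable.of_append {pXY : PMF (X × Y)} {h : List Links} {r : Links}
    (hr : P.Reachable pXY (h ++ [r])) : P.Reachable pXY h := by
  obtain ⟨x, y, hxy, hh⟩ := hr
  refine ⟨x, y, hxy, fun h0 => hh ?_⟩
  rw [List.length_append, List.length_singleton, histLaw_append, h0, zero_mul]

theorem mem_codedHistories {pXY : PMF (X × Y)} {l : Links → Bits × Bits}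
    {C D : List (Bits × Bits) → Set Bits}
    (hl : ∀ h r, P.Reachable pXY (h ++ [r]) → (l r).1 ∈ C (h.map l) ∧ (l r).2 ∈ D (h.map l))
    {h : List Links} (hh : P.Reachable pXY h) : h.map l ∈ codedHistories C D h.length := by
  induction h using List.reverseRecOn with
  | nil => rfl
  | append_singleton h r ih =>
    rw [List.length_append, List.length_singleton]
    exact ⟨h.map l, ih (hh.of_append), l r, (hl h r hh).1, (hl h r hh).2, by simp⟩

theorem LinkCoded.map_eq {pXY : PMF (X × Y)} {l : Links → Bits × Bits} {P : Protocol X Y Z}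
    (hP : P.LinkCoded pXY l) (hl : ∀ h, l (concat h) = linkConcat (h.map l)) {h h' : List Links}
    (hh : P.Reachable pXY h) (hh' : P.Reachable pXY h') (hlen : h.length = h'.length)
    (hc : l (concat h) = l (concat h')) : h.map l = h'.map l := by
  obtain ⟨C, D, hCD, hmem⟩ := hP
  refine codedHistories_unique hCD (P.mem_codedHistories hmem hh) ?_ (by rw [← hl, ← hl, hc])
  rw [hlen]
  exact P.mem_codedHistories hmem hh'

theorem concat_m12 (h : List Links) : (concat h).m12 = linkConcat (h.map Links.m12) := by
  simp [concat, linkConcat, Function.comp_def]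

theorem concat_m23 (h : List Links) : (concat h).m23 = linkConcat (h.map Links.m23) := by
  simp [concat, linkConcat, Function.comp_def]

theorem concat_m31 (h : List Links) : (concat h).m31 = linkConcat (h.map Links.m31) := by
  simp [concat, linkConcat, Function.comp_def]

theorem eq_of_map_eq {h h' : List Links} (h12 : h.map Links.m12 = h'.map Links.m12)
    (h23 : h.map Links.m23 = h'.map Links.m23) (h31 : h.map Links.m31 = h'.map Links.m31) :
    h = h' := by
  induction h generalizing h' with
  | nil => cases h' with
    | nil => rfl
    | cons r h' => simp at h12
  | cons r h ih => cases h' with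
    | nil => simp at h12
    | cons r' h' =>
      simp only [List.map_cons, List.cons.injEq] at h12 h23 h31
      rw [ih h12.2 h23.2 h31.2, Links.ext h12.1 h23.1 h31.1]

/-- Transcripts only grow, so one that already has its final value after `t` rounds keeps it at
every later time. -/
theorem concat_take_eq {h : List Links} {t t' : ℕ} {m : Links} (htt' : t ≤ t')
    (h1 : concat (h.take t) = m) (h2 : concat h = m) : concat (h.take t') = m := by
  have key : ∀ f : Links → Bits, ((h.take t).map f).flatten = (h.map f).flatten →
      ((h.take t').map f).flatten = (h.map f).flatten := by
    intro f hf
    have p1 : ((h.take t).map f).flatten <+: ((h.take t').map f).flatten :=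
      ((List.take_prefix_take_left htt').map f).flatten
    have p2 : ((h.take t').map f).flatten <+: (h.map f).flatten :=
      ((List.take_prefix t' h).map f).flatten
    exact p2.eq_of_length_le (hf ▸ p1.length_le)
  rw [← h2] at h1 ⊢
  simp only [concat, Links.mk.injEq, Prod.mk.injEq] at h1 ⊢
  exact ⟨⟨key _ h1.1.1, key _ h1.1.2⟩, ⟨key _ h1.2.1.1, key _ h1.2.1.2⟩,
    key _ h1.2.2.1, key _ h1.2.2.2⟩

/-! ### Well-formed protocols: the exchange property and Kraft's inequality. -/

variable {P}

theorem WellFormed.eq_of_concat_eq {pXY : PMF (X × Y)} (hP : P.WellFormed pXY)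
    {h h' : List Links} (hh : P.Reachable pXY h) (hh' : P.Reachable pXY h')
    (hlen : h.length = h'.length) (hc : concat h = concat h') : h = h' :=
  eq_of_map_eq (hP.coded12.map_eq concat_m12 hh hh' hlen (by rw [hc]))
    (hP.coded23.map_eq concat_m23 hh hh' hlen (by rw [hc]))
    (hP.coded31.map_eq concat_m31 hh hh' hlen (by rw [hc]))

/-- A final transcript of positive probability is realized, up to any number of rounds, by
histories of probability bounded below. -/
theorem WellFormed.exists_histories {pXY : PMF (X × Y)} (hP : P.WellFormed pXY) {x : X} {y : Y}
    (hxy : (x, y) ∈ pXY.support) {m : Links} (hm : P.finalMass x y m ≠ 0) :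
    ∃ δ : ℝ≥0∞, δ ≠ 0 ∧ ∃ t₀ : ℕ, ∀ t T, t₀ ≤ t → t ≤ T → ∃ h : List Links,
      h.length = T ∧ P.Reachable pXY h ∧ concat (h.take t) = m ∧ concat h = m ∧
        δ ≤ P.histLaw x y T h := by
  obtain ⟨t₀, ht₀⟩ : ∃ t₀, (⨅ s : ℕ, (P.histLaw x y (t₀ + s)).toOuterMeasure
      {h | concat (h.take t₀) = m ∧ concat h = m}) ≠ 0 := by
    by_contra! hcon
    exact hm (by rw [finalMass]; simp [hcon])
  refine ⟨_, ht₀, t₀, fun t T ht hT => ?_⟩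
  set δ := ⨅ s : ℕ, (P.histLaw x y (t₀ + s)).toOuterMeasure
    {h | concat (h.take t₀) = m ∧ concat h = m}
  have hδ : δ ≤ (P.histLaw x y T).toOuterMeasure {h | concat (h.take t₀) = m ∧ concat h = m} := by
    obtain ⟨s, rfl⟩ := Nat.exists_eq_add_of_le (ht.trans hT)
    exact iInf_le _ s
  set S := {h : List Links | concat (h.take t₀) = m ∧ concat h = m}
  have hreach : ∀ h ∈ (P.histLaw x y T).support, P.Reachable pXY h := fun h hh =>
    ⟨x, y, hxy, by rw [P.length_of_mem_support_histLaw hh]; exact hh⟩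
  have hne : (P.histLaw x y T).toOuterMeasure S ≠ 0 := fun h0 =>
    ht₀ (le_antisymm (hδ.trans h0.le) zero_le)
  rw [Ne, PMF.toOuterMeasure_apply_eq_zero_iff, Set.not_disjoint_iff] at hne
  obtain ⟨h, hh, hhS⟩ := hne
  refine ⟨h, P.length_of_mem_support_histLaw hh, hreach h hh, concat_take_eq ht hhS.1 hhS.2,
    hhS.2, hδ.trans_eq ?_⟩
  -- For a given number of rounds only one reachable history has the transcripts `m`, so the whole
  -- probability of the event sits on `h`.
  rw [PMF.toOuterMeasure_apply, tsum_eq_single h, Set.indicator_of_mem hhS]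
  intro h' hne
  by_contra h0
  have hS' : h' ∈ S := by
    by_contra hn
    exact h0 (Set.indicator_of_notMem hn _)
  rw [Set.indicator_of_mem hS'] at h0
  refine hne (hP.eq_of_concat_eq (hreach h' h0) (hreach h hh) ?_ (hS'.2.trans hhS.2.symm))
  rw [P.length_of_mem_support_histLaw hh, P.length_of_mem_support_histLaw h0]

/-- The exchange property of interactive protocols, for the cut that separates party 2 from the
other two parties. -/
theorem WellFormed.finalMass_ne_zero_of_exchange {pXY : PMF (X × Y)} (hP : P.WellFormed pXY)
    {x x' : X} {y y' : Y} (hxy : (x, y) ∈ pXY.support) (hxy' : (x', y') ∈ pXY.support)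
    {m m' : Links} (hm : P.finalMass x y m ≠ 0) (hm' : P.finalMass x' y' m' ≠ 0)
    (h12 : m.m12 = m'.m12) (h23 : m.m23 = m'.m23) : P.finalMass x y' m ≠ 0 := by
  obtain ⟨δ, hδ, t₀, ht⟩ := hP.exists_histories hxy hm
  obtain ⟨δ', hδ', t₀', ht'⟩ := hP.exists_histories hxy' hm'
  set t := max t₀ t₀'
  -- The bound must be uniform in `s`, as `finalMass` takes an infimum over further rounds. A
  -- product of factors at most one that is at least `δ` has every factor at least `δ`: parties 1
  -- and 3 contribute `δ` each from the first history, party 2 contributes `δ'` from the second.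
  have hmain : ∀ s, δ * δ' * δ ≤ (P.histLaw x y' (t + s)).toOuterMeasure
      {h | concat (h.take t) = m ∧ concat h = m} := by
    intro s
    obtain ⟨h, hlen, hr, htake, hc, hle⟩ := ht t (t + s) (le_max_left _ _) (Nat.le_add_right _ _)
    obtain ⟨h', hlen', hr', -, hc', hle'⟩ :=
      ht' t (t + s) (le_max_right _ _) (Nat.le_add_right _ _)
    have e12 := hP.coded12.map_eq concat_m12 hr hr' (hlen.trans hlen'.symm)
      (by rw [hc, hc', h12])
    have e23 := hP.coded23.map_eq concat_m23 hr hr' (hlen.trans hlen'.symm)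
      (by rw [hc, hc', h23])
    have hw := P.histLaw_eq_mul x y h
    have hw' := P.histLaw_eq_mul x' y' h'
    rw [hlen] at hw
    rw [hlen'] at hw'
    rw [hw] at hle
    rw [hw', ← e12, ← e23] at hle'
    have b1 : P.weight1 x (h.map Links.m12) (h.map Links.m31) ≤ 1 := sendWeight_le_one _ _ _
    have b2 : P.weight2 y (h.map Links.m12) (h.map Links.m23) ≤ 1 := sendWeight_le_one _ _ _
    have b3 : P.weight3 (h.map Links.m23) (h.map Links.m31) ≤ 1 := sendWeight_le_one _ _ _
    have l1 : δ ≤ P.weight1 x (h.map Links.m12) (h.map Links.m31) :=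
      hle.trans ((mul_le_of_le_one_right' b3).trans (mul_le_of_le_one_right' b2))
    have l3 : δ ≤ P.weight3 (h.map Links.m23) (h.map Links.m31) :=
      hle.trans (mul_le_of_le_one_left' (mul_le_one' b1 b2))
    have l2 : δ' ≤ P.weight2 y' (h.map Links.m12) (h.map Links.m23) :=
      hle'.trans ((mul_le_of_le_one_right' (sendWeight_le_one _ _ _)).trans
        (mul_le_of_le_one_left' (sendWeight_le_one _ _ _)))
    have hfin := P.histLaw_eq_mul x y' h
    rw [hlen] at hfin
    calc δ * δ' * δ ≤ P.histLaw x y' (t + s) h := by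
          rw [hfin]
          gcongr
      _ = (P.histLaw x y' (t + s)).toOuterMeasure {h} :=
          (PMF.toOuterMeasure_apply_singleton _ _).symm
      _ ≤ _ := by
          gcongr
          exact Set.singleton_subset_iff.2 ⟨htake, hc⟩
  have hpos : δ * δ' * δ ≠ 0 := mul_ne_zero (mul_ne_zero hδ hδ') hδ
  refine fun h0 => hpos (le_antisymm ?_ zero_le)
  rw [← h0, finalMass]
  exact le_iSup_of_le t (le_iInf hmain)

/-- Kraft's inequality for the final transcripts of a link. -/
theorem WellFormed.tsum_transcripts_le_one {pXY : PMF (X × Y)} (hP : P.WellFormed pXY)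
    {l : Links → Bits × Bits} (hl : P.LinkCoded pXY l)
    (hconcat : ∀ h, l (concat h) = linkConcat (h.map l)) (S : Set (Bits × Bits))
    (hS : ∀ w ∈ S, ∃ x y m, (x, y) ∈ pXY.support ∧ P.finalMass x y m ≠ 0 ∧ l m = w) :
    ∑' w : S, (2⁻¹ : ℝ≥0∞) ^ bitLength w ≤ 1 := by
  classical
  obtain ⟨C, D, hCD, hmem⟩ := hl
  have hhist : ∀ w : S, ∃ t₀, ∀ T, t₀ ≤ T → ∃ g ∈ codedHistories C D T, linkConcat g = w := by
    intro w
    obtain ⟨x, y, m, hxy, hm, hw⟩ := hS w w.2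
    obtain ⟨_, _, t₀, ht⟩ := hP.exists_histories hxy hm
    refine ⟨t₀, fun T hT => ?_⟩
    obtain ⟨h, rfl, hr, -, hc, -⟩ := ht t₀ T le_rfl hT
    exact ⟨h.map l, P.mem_codedHistories hmem hr, by rw [← hconcat, hc, hw]⟩
  choose t₀ ht₀ using hhist
  -- There need be no round by which all transcripts are complete, but finitely many are complete by
  -- the common round `F.sup t₀`, and finite sums suffice.
  rw [ENNReal.tsum_eq_iSup_sum]
  refine iSup_le fun F => ?_
  have hT : ∀ w : F, ∃ g : codedHistories C D (F.sup t₀), linkConcat g = w := fun w => by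
    obtain ⟨g, hg, hgw⟩ := ht₀ w (F.sup t₀) (Finset.le_sup w.2)
    exact ⟨⟨g, hg⟩, hgw⟩
  choose g hg using hT
  have hinj : g.Injective := fun w w' h => Subtype.ext (Subtype.ext (by rw [← hg, ← hg, h]))
  calc ∑ w ∈ F, (2⁻¹ : ℝ≥0∞) ^ bitLength w
      = ∑' w : F, (2⁻¹ : ℝ≥0∞) ^ bitLength (linkConcat (g w)) := by
        simp only [hg]
        exact (Finset.tsum_subtype F fun w => (2⁻¹ : ℝ≥0∞) ^ bitLength w).symm
    _ ≤ ∑' g : codedHistories C D (F.sup t₀), (2⁻¹ : ℝ≥0∞) ^ bitLength (linkConcat g) :=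
        ENNReal.tsum_comp_le_tsum_of_injective hinj _
    _ ≤ 1 := tsum_codedHistories_le_one hCD _

end Protocol

/-! ### Executions with a deterministic output function -/

theorem markovChain_map_iff {Ω Ω' α β γ : Type*} (μ : PMF Ω) (φ : Ω → Ω') (T : Ω' → α)
    (U : Ω' → β) (V : Ω' → γ) : MarkovChain (μ.map φ) T U V ↔
      MarkovChain μ (fun ω => T (φ ω)) (fun ω => U (φ ω)) fun ω => V (φ ω) := by
  simp only [MarkovChain, PMF.map_comp, Function.comp_def]

theorem condEntropy_map {Ω Ω' α β : Type*} (μ : PMF Ω) (φ : Ω → Ω') (T : Ω' → α)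
    (U : Ω' → β) :
    condEntropy (μ.map φ) T U = condEntropy μ (fun ω => T (φ ω)) fun ω => U (φ ω) := by
  simp only [condEntropy, PMF.map_comp, Function.comp_def]

theorem condEntropy_bind_map_mk {S M α : Type*} (p : PMF S) (κ : S → PMF M) (T : S → M → α) :
    condEntropy (p.bind fun s => (κ s).map (Prod.mk s)) (fun w => T w.1 w.2) (fun w => w.1) =
      ∑' s, p s * entropy ((κ s).map (T s)) := by
  classical
  have hfst : ((p.bind fun s => (κ s).map (Prod.mk s)).map fun w => w.1) = p :=
    map_fst_bind_map_mk p κ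
  rw [condEntropy, hfst]
  refine tsum_congr fun s => ?_
  by_cases hs : p s = 0
  · simp [hs]
  congr 2
  ext t
  have h : ((p.bind fun s => (κ s).map (Prod.mk s)).map fun w => (T w.1 w.2, w.1)) (t, s) =
      p s * ((κ s).map (T s)) t := by
    simp only [PMF.map_bind, PMF.map_comp, PMF.bind_apply]
    rw [tsum_eq_single s]
    · simp [PMF.map_apply, Function.comp_def]
    · intro s' hs'
      simp [PMF.map_apply, Function.comp_def, Ne.symm hs']
  rw [h, mul_comm, ENNReal.mul_div_cancel_right hs (p.apply_ne_top s)]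

namespace WFProtocol

variable {X Y Z : Type} {pXY : PMF (X × Y)}

/-- Law of the final transcripts on given inputs. -/
noncomputable def transcriptLaw (P : WFProtocol X Y Z pXY) (hfull : ∀ s, s ∈ pXY.support)
    (s : X × Y) : PMF Links :=
  ⟨P.finalMass s.1 s.2, ENNReal.summable.hasSum_iff.2 (P.wf.terminates s.1 s.2 (hfull s))⟩

theorem law_apply (P : WFProtocol X Y Z pXY) (ω : X × Y × Z × Links) :
    P.law ω = pXY (ω.1, ω.2.1) * P.finalMass ω.1 ω.2.1 ω.2.2.2 *
      P.out3 ω.2.2.2.m23 ω.2.2.2.m31 ω.2.2.1 := rfl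

/-- The law of the inputs and the final transcripts. -/
noncomputable def jointLaw (P : WFProtocol X Y Z pXY) (hfull : ∀ s, s ∈ pXY.support) :
    PMF ((X × Y) × Links) :=
  pXY.bind fun s => (P.transcriptLaw hfull s).map (Prod.mk s)

theorem jointLaw_apply (P : WFProtocol X Y Z pXY) (hfull : ∀ s, s ∈ pXY.support)
    (s : X × Y) (m : Links) : P.jointLaw hfull (s, m) = pXY s * P.finalMass s.1 s.2 m := by
  classical
  rw [jointLaw, PMF.bind_apply, tsum_eq_single s,
    map_apply_of_injective _ (Prod.mk_right_injective s)]
  · rfl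
  · intro s' hs'
    refine mul_eq_zero_of_right _ ((PMF.apply_eq_zero_iff _ _).2 fun hmem => ?_)
    obtain ⟨_, -, h⟩ := (PMF.mem_support_map_iff _ _ _).1 hmem
    exact hs' (Prod.mk.inj h).1

theorem law_eq_map (P : WFProtocol X Y Z pXY) (hfull : ∀ s, s ∈ pXY.support) (f : X → Y → Z)
    (hf : ∀ x y m, P.finalMass x y m ≠ 0 → P.out3 m.m23 m.m31 = PMF.pure (f x y)) :
    P.law = (P.jointLaw hfull).map fun w => (w.1.1, w.1.2, f w.1.1 w.1.2, w.2) := by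
  classical
  ext ⟨x, y, z, m⟩
  rw [law_apply, PMF.map_apply, tsum_eq_single ((x, y), m)]
  · rw [jointLaw_apply]
    by_cases hm : P.finalMass x y m = 0
    · simp [hm]
    · dsimp only
      rw [hf x y m hm, PMF.pure_apply]
      simp
  · rintro ⟨⟨x', y'⟩, m'⟩ hne
    rw [if_neg]
    simp only [Prod.mk.injEq, not_and]
    rintro rfl rfl - rfl
    exact hne rfl

/-- With full support, a wrong output on any transcript of positive mass would itself have positive
probability. -/
theorem IsSecure.out3_eq_pure {P : WFProtocol X Y Z pXY} (hfull : ∀ s, s ∈ pXY.support)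
    {f : X → Y → Z} (hP : P.IsSecure fun x y => PMF.pure (f x y)) (x : X) (y : Y) (m : Links)
    (hm : P.finalMass x y m ≠ 0) : P.out3 m.m23 m.m31 = PMF.pure (f x y) := by
  classical
  have hsupp : ∀ z ∈ (P.out3 m.m23 m.m31).support, z = f x y := by
    intro z hz
    have h0 : P.law (x, y, z, m) ≠ 0 := by
      rw [law_apply]
      exact mul_ne_zero (mul_ne_zero (hfull (x, y)) hm) hz
    have h1 := le_map_apply P.law (fun ω => (inX ω, inY ω, outZ ω)) (x, y, z, m)
    have h2 := hP.correct x y z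
    by_contra hne
    rw [PMF.pure_apply, if_neg hne, mul_zero] at h2
    exact h0 (le_antisymm (h1.trans h2.le) zero_le)
  have hset : (P.out3 m.m23 m.m31).support = {f x y} := by
    obtain ⟨z, hz⟩ := (P.out3 m.m23 m.m31).support_nonempty
    refine Set.eq_singleton_iff_unique_mem.2 ⟨hsupp z hz ▸ hz, hsupp⟩
  ext z
  by_cases hz : z = f x y
  · rw [hz, PMF.pure_apply_self, (PMF.apply_eq_one_iff _ _).2 hset]
  · rw [PMF.pure_apply_of_ne _ _ hz, PMF.apply_eq_zero_iff, hset]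
    exact hz

/-! ### Invariance of the transcript laws under privacy. -/

section Deterministic

variable {P : WFProtocol X Y Z pXY} {f : X → Y → Z}

theorem law_map_transcript (P : WFProtocol X Y Z pXY) (hfull : ∀ s, s ∈ pXY.support)
    (hf : ∀ x y m, P.finalMass x y m ≠ 0 → P.out3 m.m23 m.m31 = PMF.pure (f x y))
    {α : Type*} (l : Links → α) :
    (P.law.map fun ω => l ω.2.2.2) = pXY.bind fun s => (P.transcriptLaw hfull s).map l := by
  rw [P.law_eq_map hfull f hf, jointLaw]
  simp only [PMF.map_comp, PMF.map_bind, Function.comp_def]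

theorem randomness_eq (P : WFProtocol X Y Z pXY) (hfull : ∀ s, s ∈ pXY.support)
    (hf : ∀ x y m, P.finalMass x y m ≠ 0 → P.out3 m.m23 m.m31 = PMF.pure (f x y)) :
    P.randomness = ∑' s, pXY s * entropy ((P.transcriptLaw hfull s).map fun m =>
      (((m.m12, m.m31), s.1), ((m.m12, m.m23), s.2), ((m.m23, m.m31), f s.1 s.2))) := by
  rw [randomness, P.law_eq_map hfull f hf, condEntropy_map, jointLaw]
  exact condEntropy_bind_map_mk pXY (P.transcriptLaw hfull) fun s m =>
    (((m.m12, m.m31), s.1), ((m.m12, m.m23), s.2), ((m.m23, m.m31), f s.1 s.2))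

theorem IsSecure.map_m12_m31_eq (hfull : ∀ s, s ∈ pXY.support)
    (hP : P.IsSecure fun x y => PMF.pure (f x y)) (x : X) (y y' : Y) :
    (P.transcriptLaw hfull (x, y)).map (fun m => (m.m12, m.m31)) =
      (P.transcriptLaw hfull (x, y')).map fun m => (m.m12, m.m31) := by
  have h := hP.private1
  rw [P.law_eq_map hfull f (hP.out3_eq_pure hfull), markovChain_map_iff, jointLaw] at h
  exact map_eq_of_markovChain pXY hfull (P.transcriptLaw hfull) (fun m => (m.m12, m.m31))
    Prod.fst (fun s => (s.2, f s.1 s.2))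
    (fun s s' h => Prod.ext (Prod.mk.inj h).1 (Prod.mk.inj (Prod.mk.inj h).2).1) h _ _ rfl

theorem IsSecure.map_m12_m23_eq (hfull : ∀ s, s ∈ pXY.support)
    (hP : P.IsSecure fun x y => PMF.pure (f x y)) (x x' : X) (y : Y) :
    (P.transcriptLaw hfull (x, y)).map (fun m => (m.m12, m.m23)) =
      (P.transcriptLaw hfull (x', y)).map fun m => (m.m12, m.m23) := by
  have h := hP.private2
  rw [P.law_eq_map hfull f (hP.out3_eq_pure hfull), markovChain_map_iff, jointLaw] at h
  exact map_eq_of_markovChain pXY hfull (P.transcriptLaw hfull) (fun m => (m.m12, m.m23))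
    Prod.snd (fun s => (s.1, f s.1 s.2))
    (fun s s' h => Prod.ext (Prod.mk.inj (Prod.mk.inj h).2).1 (Prod.mk.inj h).1) h _ _ rfl

theorem IsSecure.map_m23_m31_eq (hfull : ∀ s, s ∈ pXY.support)
    (hP : P.IsSecure fun x y => PMF.pure (f x y)) {x x' : X} {y y' : Y}
    (hxy : f x y = f x' y') :
    (P.transcriptLaw hfull (x, y)).map (fun m => (m.m23, m.m31)) =
      (P.transcriptLaw hfull (x', y')).map fun m => (m.m23, m.m31) := by
  have h := hP.private3
  rw [P.law_eq_map hfull f (hP.out3_eq_pure hfull), markovChain_map_iff, jointLaw] at h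
  exact map_eq_of_markovChain pXY hfull (P.transcriptLaw hfull) (fun m => (m.m23, m.m31))
    (fun s => f s.1 s.2) id (fun s s' h => (Prod.mk.inj h).2) h _ _ hxy

/-- Privacy against party 1 removes the dependence on `y`, privacy against party 2 that on `x`. -/
theorem IsSecure.map_m12_eq (hfull : ∀ s, s ∈ pXY.support)
    (hP : P.IsSecure fun x y => PMF.pure (f x y)) (s s' : X × Y) :
    (P.transcriptLaw hfull s).map Links.m12 = (P.transcriptLaw hfull s').map Links.m12 := by
  have h1 := congrArg (PMF.map Prod.fst) (hP.map_m12_m31_eq hfull s.1 s.2 s'.2)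
  have h2 := congrArg (PMF.map Prod.fst) (hP.map_m12_m23_eq hfull s.1 s'.1 s'.2)
  simp only [PMF.map_comp] at h1 h2
  exact h1.trans h2

theorem IsSecure.map_m31_eq (hfull : ∀ s, s ∈ pXY.support)
    (hP : P.IsSecure fun x y => PMF.pure (f x y)) (x : X) (y y' : Y) :
    (P.transcriptLaw hfull (x, y)).map Links.m31 =
      (P.transcriptLaw hfull (x, y')).map Links.m31 := by
  have h1 := congrArg (PMF.map Prod.snd) (hP.map_m12_m31_eq hfull x y y')
  simp only [PMF.map_comp] at h1
  exact h1

/-- Privacy against party 2 allows `x` to be changed freely. At `x₀` the output does not depend on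
`y`, so there privacy against party 3 allows `y` to be changed; the path from `s` to `s'` therefore
passes through `x₀`. -/
theorem IsSecure.map_m23_eq (hfull : ∀ s, s ∈ pXY.support)
    (hP : P.IsSecure fun x y => PMF.pure (f x y)) (x₀ : X) (hx₀ : ∀ y y', f x₀ y = f x₀ y')
    (s s' : X × Y) :
    (P.transcriptLaw hfull s).map Links.m23 = (P.transcriptLaw hfull s').map Links.m23 := by
  have h1 := congrArg (PMF.map Prod.snd) (hP.map_m12_m23_eq hfull s.1 x₀ s.2)
  have h2 := congrArg (PMF.map Prod.fst) (hP.map_m23_m31_eq hfull (hx₀ s.2 s'.2))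
  have h3 := congrArg (PMF.map Prod.snd) (hP.map_m12_m23_eq hfull x₀ s'.1 s'.2)
  simp only [PMF.map_comp] at h1 h2 h3
  exact h1.trans (h2.trans h3)

/-- If `y` is a function of the output at `x₁`, then it is a function of the transcripts of the
links of party 2. -/
theorem IsSecure.eq_of_transcripts_eq (hfull : ∀ s, s ∈ pXY.support)
    (hP : P.IsSecure fun x y => PMF.pure (f x y)) {x₁ : X} (hx₁ : Function.Injective (f x₁))
    {y y' : Y} {m m' : Links} (hm : P.finalMass x₁ y m ≠ 0) (hm' : P.finalMass x₁ y' m' ≠ 0)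
    (h12 : m.m12 = m'.m12) (h23 : m.m23 = m'.m23) : y = y' := by
  -- By exchange of party 2, `m` also occurs on inputs `(x₁, y')`, so its output is both `f x₁ y`
  -- and `f x₁ y'`.
  have h := P.wf.finalMass_ne_zero_of_exchange (hfull _) (hfull _) hm hm' h12 h23
  have e : PMF.pure (f x₁ y) = PMF.pure (f x₁ y') :=
    (hP.out3_eq_pure hfull _ _ m hm).symm.trans (hP.out3_eq_pure hfull _ _ m h)
  have := congrArg PMF.support e
  rw [PMF.support_pure, PMF.support_pure] at this
  exact hx₁ (Set.singleton_injective this)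

theorem IsSecure.exists_decoder (hfull : ∀ s, s ∈ pXY.support)
    (hP : P.IsSecure fun x y => PMF.pure (f x y)) {x₁ : X} (hx₁ : Function.Injective (f x₁)) :
    ∃ g : Bits × Bits → Bits × Bits → Y, ∀ y m, P.finalMass x₁ y m ≠ 0 → g m.m12 m.m23 = y := by
  classical
  obtain ⟨⟨-, y₀⟩, -⟩ := pXY.support_nonempty
  refine ⟨fun a b => if h : ∃ y m, P.finalMass x₁ y m ≠ 0 ∧ m.m12 = a ∧ m.m23 = b then h.choose
    else y₀, fun y m hm => ?_⟩
  have h : ∃ y' m', P.finalMass x₁ y' m' ≠ 0 ∧ m'.m12 = m.m12 ∧ m'.m23 = m.m23 :=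
    ⟨y, m, hm, rfl, rfl⟩
  dsimp only
  rw [dif_pos h]
  obtain ⟨m', hm', h12, h23⟩ := h.choose_spec
  exact hP.eq_of_transcripts_eq hfull hx₁ hm' hm h12 h23

/-! ### Lower bounds on the transcripts -/

/-- At `x₁` the transcripts `M12` and `M23` determine `y`, while `M23` alone is independent of it.
The law of `M12` does not depend on the inputs, so `y` may be drawn from any `π`. -/
theorem IsSecure.entropy_le_m12 (hfull : ∀ s, s ∈ pXY.support)
    (hP : P.IsSecure fun x y => PMF.pure (f x y)) {x₀ x₁ : X} (hx₀ : ∀ y y', f x₀ y = f x₀ y')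
    (hx₁ : Function.Injective (f x₁)) (π : PMF Y) (s : X × Y) :
    entropy π ≤ entropy ((P.transcriptLaw hfull s).map Links.m12) := by
  obtain ⟨g, hg⟩ := hP.exists_decoder hfull hx₁
  have h := entropy_map_le_entropy_bind_map π (fun y => P.transcriptLaw hfull (x₁, y))
    Links.m12 Links.m23 id g _ (fun y => hP.map_m23_eq hfull x₀ hx₀ (x₁, y) s)
    fun y m hm => hg y m hm
  simp only [hP.map_m12_eq hfull _ s, PMF.bind_const, PMF.map_id] at h
  exact h

theorem IsSecure.entropy_le_m23 (hfull : ∀ s, s ∈ pXY.support)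
    (hP : P.IsSecure fun x y => PMF.pure (f x y)) {x₀ x₁ : X} (hx₀ : ∀ y y', f x₀ y = f x₀ y')
    (hx₁ : Function.Injective (f x₁)) (π : PMF Y) (s : X × Y) :
    entropy π ≤ entropy ((P.transcriptLaw hfull s).map Links.m23) := by
  obtain ⟨g, hg⟩ := hP.exists_decoder hfull hx₁
  have h := entropy_map_le_entropy_bind_map π (fun y => P.transcriptLaw hfull (x₁, y))
    Links.m23 Links.m12 id (fun a b => g b a) _ (fun y => hP.map_m12_eq hfull (x₁, y) s)
    fun y m hm => hg y m hm
  simp only [hP.map_m23_eq hfull x₀ hx₀ _ s, PMF.bind_const, PMF.map_id] at h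
  exact h

theorem IsSecure.entropyOf_M12_ge (hfull : ∀ s, s ∈ pXY.support)
    (hP : P.IsSecure fun x y => PMF.pure (f x y)) {x₀ x₁ : X} (hx₀ : ∀ y y', f x₀ y = f x₀ y')
    (hx₁ : Function.Injective (f x₁)) (π : PMF Y) : entropy π ≤ entropyOf P.law M12 := by
  obtain ⟨s, -⟩ := pXY.support_nonempty
  have h : P.law.map M12 = _ := P.law_map_transcript hfull (hP.out3_eq_pure hfull) Links.m12
  rw [entropyOf, h]
  simp only [hP.map_m12_eq hfull _ s, PMF.bind_const]
  exact hP.entropy_le_m12 hfull hx₀ hx₁ π s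

theorem IsSecure.entropyOf_M23_ge (hfull : ∀ s, s ∈ pXY.support)
    (hP : P.IsSecure fun x y => PMF.pure (f x y)) {x₀ x₁ : X} (hx₀ : ∀ y y', f x₀ y = f x₀ y')
    (hx₁ : Function.Injective (f x₁)) (π : PMF Y) : entropy π ≤ entropyOf P.law M23 := by
  obtain ⟨s, -⟩ := pXY.support_nonempty
  have h : P.law.map M23 = _ := P.law_map_transcript hfull (hP.out3_eq_pure hfull) Links.m23
  rw [entropyOf, h]
  simp only [hP.map_m23_eq hfull x₀ hx₀ _ s, PMF.bind_const]
  exact hP.entropy_le_m23 hfull hx₀ hx₁ π s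

/-- The law of `Y` may be replaced by any other law, independent of `X`. -/
theorem IsSecure.entropyOf_M31_ge (hfull : ∀ s, s ∈ pXY.support)
    (hP : P.IsSecure fun x y => PMF.pure (f x y)) {x₀ : X} (hx₀ : ∀ y y', f x₀ y = f x₀ y')
    (π : PMF Y) :
    entropy ((pXY.map Prod.fst).bind fun x => π.map (f x)) ≤ entropyOf P.law M31 := by
  obtain ⟨s, -⟩ := pXY.support_nonempty
  have h : P.law.map M31 = _ := P.law_map_transcript hfull (hP.out3_eq_pure hfull) Links.m31
  -- The protocol is run on `x` from its true marginal and an independent `y` from `π`. `M23` is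
  -- independent of these inputs and, with `M31`, determines the output.
  have hcore := entropy_map_le_entropy_bind_map
    ((pXY.map Prod.fst).bind fun x => π.map (Prod.mk x)) (P.transcriptLaw hfull)
    Links.m31 Links.m23 (fun s => f s.1 s.2) (fun a b => (P.out3 b a).support_nonempty.some) _
    (fun s' => hP.map_m23_eq hfull x₀ hx₀ s' s) fun s' m hm => by
      have h1 := hP.out3_eq_pure hfull s'.1 s'.2 m hm
      have h2 := (P.out3 m.m23 m.m31).support_nonempty.some_mem
      have h3 : (P.out3 m.m23 m.m31).support = {f s'.1 s'.2} := by rw [h1, PMF.support_pure]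
      exact (Set.ext_iff.1 h3 _).1 h2
  have e1 : ((pXY.map Prod.fst).bind fun x => π.map (Prod.mk x)).map (fun s => f s.1 s.2) =
      (pXY.map Prod.fst).bind fun x => π.map (f x) := by
    simp only [PMF.map_bind, PMF.map_comp, Function.comp_def]
  -- As the law of `M31` depends on `x` only, redrawing `y` does not change it.
  have e2 : (((pXY.map Prod.fst).bind fun x => π.map (Prod.mk x)).bind fun s =>
      (P.transcriptLaw hfull s).map Links.m31) = P.law.map M31 := by
    rw [h, PMF.bind_bind, PMF.bind_map]
    refine congrArg pXY.bind (funext fun s' => ?_)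
    rw [Function.comp_apply, PMF.bind_map]
    exact (congrArg π.bind (funext fun y => hP.map_m31_eq hfull s'.1 y s'.2)).trans
      (PMF.bind_const _ _)
  rw [e1, e2] at hcore
  exact hcore

/-- `M12` is part of the views, and given any inputs it already has entropy at least that of `π`. -/
theorem IsSecure.randomness_ge (hfull : ∀ s, s ∈ pXY.support)
    (hP : P.IsSecure fun x y => PMF.pure (f x y)) {x₀ x₁ : X} (hx₀ : ∀ y y', f x₀ y = f x₀ y')
    (hx₁ : Function.Injective (f x₁)) (π : PMF Y) : entropy π ≤ P.randomness := by
  rw [P.randomness_eq hfull (hP.out3_eq_pure hfull)]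
  calc entropy π = ∑' s, pXY s * entropy π := by
        rw [ENNReal.tsum_mul_right, pXY.tsum_coe, one_mul]
    _ ≤ _ := by
        refine ENNReal.tsum_le_tsum fun s => ?_
        gcongr
        refine (hP.entropy_le_m12 hfull hx₀ hx₁ π s).trans ?_
        refine le_trans (le_of_eq ?_) (entropy_map_le _ fun w => w.1.1.1)
        rw [PMF.map_comp]
        rfl

end Deterministic

/-- The expected length of a transcript is at least its entropy. -/
theorem entropyOf_le_expectation_bitLength (P : WFProtocol X Y Z pXY)
    {l : Links → Bits × Bits} (hl : P.LinkCoded pXY l)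
    (hconcat : ∀ h, l (concat h) = linkConcat (h.map l)) :
    entropyOf P.law (fun ω => l ω.2.2.2) ≤ expectation P.law fun ω => bitLength (l ω.2.2.2) := by
  have hexp : expectation (P.law.map fun ω => l ω.2.2.2) bitLength =
      expectation P.law fun ω => bitLength (l ω.2.2.2) :=
    tsum_map_mul _ _ fun w => (bitLength w : ℝ≥0∞)
  rw [entropyOf, ← hexp]
  refine entropy_le_expectation _ bitLength ?_
  refine P.wf.tsum_transcripts_le_one hl hconcat _ fun w hw => ?_
  obtain ⟨ω, hω, hw⟩ := (PMF.mem_support_map_iff _ _ _).1 hw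
  rw [PMF.mem_support_iff, law_apply] at hω
  exact ⟨ω.1, ω.2.1, ω.2.2.2, left_ne_zero_of_mul (left_ne_zero_of_mul hω),
    right_ne_zero_of_mul (left_ne_zero_of_mul hω), hw⟩

end WFProtocol

/-! ### The entropy of the output of controlled erasure -/

/-- Both strings have independent letters and erasure acts letterwise, so the double sum over
strings becomes a product over positions of sums over pairs of bits. -/
theorem bind_map_erase_apply {n : ℕ} {PX : PMF (Fin n → Bool)} {p : ℝ}
    (hp : p ∈ Set.Ioo (0 : ℝ) 1) (hX : IsIIDBernoulli PX p) (z : Fin n → Option Bool) :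
    (PX.bind fun x => (PMF.uniformOfFintype (Fin n → Bool)).map (erase x)) z =
      ∏ i, ENNReal.ofReal (Option.elim (z i) (1 - p) fun _ => p / 2) := by
  classical
  have hp0 := hp.1
  have hp1 : 0 < 1 - p := sub_pos.2 hp.2
  calc (PX.bind fun x => (PMF.uniformOfFintype (Fin n → Bool)).map (erase x)) z
      = ∑ x : Fin n → Bool, ∑ y : Fin n → Bool, ∏ i, (ENNReal.ofReal (if x i then p else 1 - p) *
          (ENNReal.ofReal (1 / 2) * if z i = (if x i then some (y i) else none) then 1 else 0)) := by
        rw [PMF.bind_apply, tsum_fintype]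
        refine Finset.sum_congr rfl fun x _ => ?_
        rw [PMF.map_apply, tsum_fintype, Finset.mul_sum]
        refine Finset.sum_congr rfl fun y _ => ?_
        rw [hX, Finset.prod_mul_distrib, Finset.prod_mul_distrib, uniformOfFintype_eq_prod,
          Finset.prod_ite_zero]
        simp only [funext_iff, erase, Finset.mem_univ, true_implies, Finset.prod_const_one,
          mul_ite, mul_one, mul_zero]
    _ = ∑ w : Fin n → Bool × Bool, ∏ i, (ENNReal.ofReal (if (w i).1 then p else 1 - p) *
          (ENNReal.ofReal (1 / 2) *
            if z i = (if (w i).1 then some (w i).2 else none) then 1 else 0)) := by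
        rw [← (Equiv.arrowProdEquivProdArrow (Fin n) (fun _ => Bool) fun _ => Bool).symm.sum_comp,
          Fintype.sum_prod_type]
        rfl
    _ = ∏ i, ∑ w : Bool × Bool, (ENNReal.ofReal (if w.1 then p else 1 - p) *
          (ENNReal.ofReal (1 / 2) *
            if z i = (if w.1 then some w.2 else none) then 1 else 0)) := by
        rw [Finset.prod_univ_sum, Fintype.piFinset_univ]
    _ = _ := by
        refine Finset.prod_congr rfl fun i _ => ?_
        rw [Fintype.sum_prod_type]
        rcases z i with _ | b
        · simp only [Fintype.sum_bool, Option.elim]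
          simp only [if_true, Bool.false_eq_true, if_false, reduceCtorEq, mul_zero, zero_add,
            mul_one]
          rw [← ENNReal.ofReal_mul hp1.le, ← ENNReal.ofReal_add (by positivity) (by positivity)]
          congr 1
          ring
        · cases b <;>
          · simp only [Fintype.sum_bool, Option.elim]
            simp only [if_true, Bool.false_eq_true, if_false, reduceCtorEq, mul_zero, zero_add,
              mul_one, add_zero, Option.some.injEq, Bool.true_eq_false]
            rw [← ENNReal.ofReal_mul hp0.le]
            congr 1
            ring

/-- Per letter, the erasure pattern costs `H₂(p)` bits, and with probability `p` one further uniform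
bit is shown. -/
theorem entropy_bind_map_erase {n : ℕ} {PX : PMF (Fin n → Bool)} {p : ℝ}
    (hp : p ∈ Set.Ioo (0 : ℝ) 1) (hX : IsIIDBernoulli PX p) :
    entropy (PX.bind fun x => (PMF.uniformOfFintype (Fin n → Bool)).map (erase x)) =
      ENNReal.ofReal (n * (binaryEntropy p + p)) := by
  have hp0 := hp.1
  have hp1 : 0 < 1 - p := sub_pos.2 hp.2
  have hlog : Real.log 2 ≠ 0 := (Real.log_pos one_lt_two).ne'
  rw [entropy_prod _ (fun z => Option.elim z (1 - p) fun _ => p / 2) _ _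
    (bind_map_erase_apply hp hX)]
  · congr 2
    rw [binaryEntropy, Real.binEntropy_eq_negMulLog_add_negMulLog_one_sub]
    simp only [Fintype.sum_option, Option.elim, Finset.sum_const, Finset.card_univ,
      Fintype.card_bool, nsmul_eq_mul, Real.negMulLog, Real.log_div hp0.ne' two_ne_zero]
    field_simp
    push_cast
    ring
  · rintro (_ | b)
    · exact hp1.le
    · exact (half_pos hp0).le
  · simp only [Fintype.sum_option, Option.elim, Finset.sum_const, Finset.card_univ,
      Fintype.card_bool, nsmul_eq_mul]
    push_cast
    ring

theorem erase_false {n : ℕ} (y y' : Fin n → Bool) :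
    erase (fun _ => false) y = erase (fun _ => false) y' := rfl

theorem erase_true_injective (n : ℕ) : Function.Injective (erase fun _ : Fin n => true) := by
  intro y y' h
  funext i
  simpa [erase] using congrFun h i

/-! ### Selecting and decoding bits -/

theorem selectBits_eq_map {n : ℕ} (x : Fin n → Bool) (k : Bits) :
    selectBits x k =
      ((List.finRange n).filter fun i => x i).map fun i : Fin n => k.getD i false := by
  simp [selectBits, ← List.map_eq_flatMap, Function.comp_def]

theorem selectBits_ofFn {n : ℕ} (x k : Fin n → Bool) :
    selectBits x (List.ofFn k) = ((List.finRange n).filter fun i => x i).map k := by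
  rw [selectBits_eq_map]
  refine List.map_congr_left fun i _ => ?_
  simp [List.getD_eq_getElem?_getD]

theorem length_selectBits {n : ℕ} (x : Fin n → Bool) (k : Bits) :
    (selectBits x k).length = (Finset.univ.filter fun i => x i = true).card := by
  rw [selectBits_eq_map, List.length_map,
    ← List.toFinset_card_of_nodup ((List.nodup_finRange n).filter _)]
  congr 1
  ext i
  simp

/-- Splitting `finRange n` at `i`, the selected positions before `i` are those in the first part, so
their number is the index of `i` after filtering. -/
theorem getElem?_filter_finRange {n : ℕ} (x : Fin n → Bool) (i : Fin n) (hi : x i = true) :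
    ((List.finRange n).filter fun j => x j)[(Finset.univ.filter fun j => j < i ∧ x j).card]? =
      some i := by
  have hsplit : List.finRange n =
      (List.finRange n).take i ++ i :: (List.finRange n).drop (i + 1) := by
    conv_lhs => rw [← List.take_append_drop i (List.finRange n)]
    rw [List.drop_eq_getElem_cons (by simp)]
    simp
  have hmem : ∀ j, j ∈ (List.finRange n).take i ↔ j < i := by
    intro j
    rw [List.mem_take_iff_getElem]
    constructor
    · rintro ⟨a, ha, rfl⟩
      rw [List.length_finRange] at ha
      rw [Fin.lt_def]
      simp only [List.getElem_finRange, Fin.val_cast]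
      omega
    · intro hj
      exact ⟨j, by simp [Fin.lt_def.1 hj], by simp⟩
  have hcard : (((List.finRange n).take i).filter fun j => x j).length =
      (Finset.univ.filter fun j => j < i ∧ x j).card := by
    rw [← List.toFinset_card_of_nodup
      (((List.nodup_finRange n).sublist (List.take_sublist _ _)).filter _)]
    congr 1
    ext j
    simp [hmem]
  rw [hsplit, List.filter_append, List.filter_cons_of_pos hi, ← hcard]
  simp

/-- Only `c x` can be a codeword prefixing the received string, so `choose` must return `x`; the key
then cancels at the selected positions. -/
theorem decode_eq_erase {n : ℕ} {c : (Fin n → Bool) → Bits} (hc : IsPrefixCode c)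
    (x y k : Fin n → Bool) :
    decode c (List.ofFn fun i => xor (y i) (k i)) (c x ++ selectBits x (List.ofFn k)) =
      erase x y := by
  classical
  have h : ∃ x', c x' <+: c x ++ selectBits x (List.ofFn k) := ⟨x, List.prefix_append _ _⟩
  have hx : h.choose = x := by
    rcases List.prefix_or_prefix_of_prefix h.choose_spec
      (List.prefix_append (c x) (selectBits x (List.ofFn k))) with h' | h'
    · exact hc _ _ h'
    · exact (hc _ _ h').symm
  rw [decode, dif_pos h]
  funext i
  simp only [hx, erase, List.drop_left]
  by_cases hi : x i = true
  · rw [if_pos hi, if_pos hi, selectBits_ofFn]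
    have hget := getElem?_filter_finRange x i hi
    simp [List.getD_eq_getElem?_getD, hget]
  · rw [if_neg hi, if_neg hi]

/-! ### Uniform keys -/

theorem uniformOfFintype_map_equiv {α : Type*} [Fintype α] [Nonempty α] (e : α ≃ α) :
    (PMF.uniformOfFintype α).map e = PMF.uniformOfFintype α := by
  ext a
  obtain ⟨b, rfl⟩ := e.surjective a
  rw [map_apply_of_injective _ e.injective]
  simp

/-- Masking with `y`. -/
def xorEquiv {n : ℕ} (y : Fin n → Bool) : (Fin n → Bool) ≃ (Fin n → Bool) where
  toFun k i := xor (y i) (k i)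
  invFun k i := xor (y i) (k i)
  left_inv k := by funext i; simp
  right_inv k := by funext i; simp

/-- The one-time pad: masking by a fixed string permutes the keys. -/
theorem uniformOfFintype_map_xor {n : ℕ} {α : Type*} (y : Fin n → Bool)
    (T : (Fin n → Bool) → α) :
    (PMF.uniformOfFintype (Fin n → Bool)).map (fun k => T fun i => xor (y i) (k i)) =
      (PMF.uniformOfFintype (Fin n → Bool)).map T := by
  conv_rhs => rw [← uniformOfFintype_map_equiv (xorEquiv y), PMF.map_comp]
  rfl

/-! ### The executions of the erasure protocol -/

section ErasureProtocol

variable {n : ℕ} {c : (Fin n → Bool) → Bits}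

/-- The final transcripts of the erasure protocol with inputs `x, y` and key `k`. -/
def erasureTranscript (c : (Fin n → Bool) → Bits) (x y k : Fin n → Bool) : Links where
  m12 := ([], List.ofFn k)
  m23 := (List.ofFn fun i => xor (y i) (k i), [])
  m31 := ([], c x ++ selectBits x (List.ofFn k))

/-- The messages of `t + 2` rounds of the erasure protocol with inputs `x, y` and key `k`. -/
def erasureHistory (c : (Fin n → Bool) → Bits) (x y k : Fin n → Bool) (t : ℕ) : List Links :=
  ⟨([], List.ofFn k), (List.ofFn fun i => xor (y i) (k i), []), ([], [])⟩ ::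
    ⟨([], []), ([], []), ([], c x ++ selectBits x (List.ofFn k))⟩ ::
      List.replicate t ⟨([], []), ([], []), ([], [])⟩

theorem roundLaw_erasureProtocol_nil (x y : Fin n → Bool) :
    (erasureProtocol n c).roundLaw x y [] = (PMF.uniformOfFintype (Fin n → Bool)).map fun k =>
      ⟨([], List.ofFn k), (List.ofFn fun i => xor (y i) (k i), []), ([], [])⟩ := by
  simp only [Protocol.roundLaw, erasureProtocol, List.map_nil, PMF.pure_bind, PMF.bind_map]
  rfl

theorem roundLaw_erasureProtocol_singleton (x y : Fin n → Bool) (r : Links) :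
    (erasureProtocol n c).roundLaw x y [r] =
      PMF.pure ⟨([], []), ([], []), ([], c x ++ selectBits x r.m12.2)⟩ := by
  simp only [Protocol.roundLaw, erasureProtocol, List.map_cons, List.map_nil, PMF.pure_bind]

theorem roundLaw_erasureProtocol_cons_cons (x y : Fin n → Bool) (r r' : Links) (h : List Links) :
    (erasureProtocol n c).roundLaw x y (r :: r' :: h) =
      PMF.pure ⟨([], []), ([], []), ([], [])⟩ := by
  simp only [Protocol.roundLaw, erasureProtocol, List.map_cons, PMF.pure_bind]

theorem histLaw_erasureProtocol (x y : Fin n → Bool) (t : ℕ) :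
    (erasureProtocol n c).histLaw x y (t + 2) =
      (PMF.uniformOfFintype (Fin n → Bool)).map fun k => erasureHistory c x y k t := by
  induction t with
  | zero =>
    simp only [Protocol.histLaw, PMF.pure_bind, roundLaw_erasureProtocol_nil, PMF.bind_map,
      PMF.map_comp, List.nil_append]
    simp only [Function.comp_def, roundLaw_erasureProtocol_singleton, PMF.pure_map]
    rfl
  | succ t ih =>
    rw [show t + 1 + 2 = t + 2 + 1 by ring, Protocol.histLaw, ih, PMF.bind_map]
    simp only [Function.comp_def, erasureHistory, roundLaw_erasureProtocol_cons_cons,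
      PMF.pure_map, List.replicate_succ']
    rfl

theorem concat_take_erasureHistory (x y k : Fin n → Bool) (s t : ℕ) :
    concat ((erasureHistory c x y k t).take (s + 2)) = erasureTranscript c x y k := by
  simp [erasureHistory, concat, erasureTranscript]

theorem concat_erasureHistory (x y k : Fin n → Bool) (t : ℕ) :
    concat (erasureHistory c x y k t) = erasureTranscript c x y k := by
  simp [erasureHistory, concat, erasureTranscript]

/-- All bits are sent within two rounds: `s = 2` bounds every infimum from above, and `t = 2`
attains the supremum. -/
theorem finalMass_erasureProtocol (x y : Fin n → Bool) (m : Links) :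
    (erasureProtocol n c).finalMass x y m =
      ((PMF.uniformOfFintype (Fin n → Bool)).map (erasureTranscript c x y)) m := by
  rw [← PMF.toOuterMeasure_apply_singleton, PMF.toOuterMeasure_map_apply, Protocol.finalMass]
  refine le_antisymm (iSup_le fun t => iInf_le_of_le 2 ?_) (le_iSup_of_le 2 (le_iInf fun s => ?_))
  · rw [histLaw_erasureProtocol, PMF.toOuterMeasure_map_apply]
    gcongr
    rintro k ⟨-, hk⟩
    rw [concat_erasureHistory] at hk
    exact hk
  · rw [add_comm, histLaw_erasureProtocol, PMF.toOuterMeasure_map_apply]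
    gcongr
    intro k hk
    exact ⟨(concat_take_erasureHistory x y k 0 s).trans hk, (concat_erasureHistory x y k s).trans hk⟩

theorem prefixFree_singleton (w : Bits) : PrefixFree {w} := by
  rintro u rfl v rfl _
  rfl

theorem prefixFree_setOf_length_eq (n : ℕ) : PrefixFree {w : Bits | w.length = n} :=
  fun _ hu _ hv h => h.eq_of_length (hu.trans hv.symm)

/-- `c x` reveals `x`, hence also the number of key bits that follow, so the message is
self-delimiting. -/
theorem prefixFree_code_append (hc : IsPrefixCode c) :
    PrefixFree {w : Bits | ∃ x s, s.length = (Finset.univ.filter fun i => x i = true).card ∧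
      w = c x ++ s} := by
  rintro _ ⟨x, s, hs, rfl⟩ _ ⟨x', s', hs', rfl⟩ h
  have hx : x = x' := by
    rcases List.prefix_or_prefix_of_prefix ((List.prefix_append (c x) s).trans h)
      (List.prefix_append (c x') s') with h' | h'
    · exact hc _ _ h'
    · exact (hc _ _ h').symm
  subst hx
  exact h.eq_of_length (by rw [List.length_append, List.length_append, hs, hs'])

theorem wellFormed_erasureProtocol (hc : IsPrefixCode c)
    (pXY : PMF ((Fin n → Bool) × (Fin n → Bool))) : (erasureProtocol n c).WellFormed pXY := by
  have hround : ∀ h r, (erasureProtocol n c).Reachable pXY (h ++ [r]) →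
      ∃ x y, r ∈ ((erasureProtocol n c).roundLaw x y h).support := by
    rintro h r ⟨x, y, -, hh⟩
    rw [List.length_append, List.length_singleton, PMF.mem_support_iff,
      Protocol.histLaw_append] at hh
    exact ⟨x, y, right_ne_zero_of_mul hh⟩
  have hcases : ∀ h r, (erasureProtocol n c).Reachable pXY (h ++ [r]) →
      (h = [] ∧ ∃ y k : Fin n → Bool, r =
        ⟨([], List.ofFn k), (List.ofFn fun i => xor (y i) (k i), []), ([], [])⟩) ∨
      ∃ r₀ h', h = r₀ :: h' ∧ ∃ x : Fin n → Bool, ∃ s : Bits,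
        s.length = (Finset.univ.filter fun i => x i = true).card ∧
        r = ⟨([], []), ([], []), ([], if h' = [] then c x ++ s else [])⟩ := by
    rintro (_ | ⟨r₀, _ | ⟨r₁, h⟩⟩) r hr
    · obtain ⟨x, y, hr⟩ := hround _ _ hr
      rw [roundLaw_erasureProtocol_nil] at hr
      obtain ⟨k, -, rfl⟩ := (PMF.mem_support_map_iff _ _ _).1 hr
      exact Or.inl ⟨rfl, y, k, rfl⟩
    · obtain ⟨x, y, hr⟩ := hround _ _ hr
      rw [roundLaw_erasureProtocol_singleton, PMF.mem_support_pure_iff] at hr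
      exact Or.inr ⟨r₀, [], rfl, x, _, length_selectBits x r₀.m12.2, by rw [hr, if_pos rfl]⟩
    · obtain ⟨x, y, hr⟩ := hround _ _ hr
      rw [roundLaw_erasureProtocol_cons_cons, PMF.mem_support_pure_iff] at hr
      exact Or.inr ⟨r₀, _, rfl, x, _, length_selectBits x [], by
        rw [hr, if_neg (List.cons_ne_nil _ _)]⟩
  refine ⟨?_, ?_, ?_, ?_⟩
  · refine ⟨fun _ => {[]}, fun g => if g = [] then {w | w.length = n} else {[]},
      fun g => ⟨prefixFree_singleton _, ?_⟩, fun h r hr => ?_⟩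
    · dsimp only
      split_ifs
      exacts [prefixFree_setOf_length_eq n, prefixFree_singleton _]
    · rcases hcases h r hr with ⟨rfl, y, k, rfl⟩ | ⟨r₀, h', rfl, x, s, -, rfl⟩ <;> simp
  · refine ⟨fun g => if g = [] then {w | w.length = n} else {[]}, fun _ => {[]},
      fun g => ⟨?_, prefixFree_singleton _⟩, fun h r hr => ?_⟩
    · dsimp only
      split_ifs
      exacts [prefixFree_setOf_length_eq n, prefixFree_singleton _]
    · rcases hcases h r hr with ⟨rfl, y, k, rfl⟩ | ⟨r₀, h', rfl, x, s, -, rfl⟩ <;> simp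
  -- Alice speaks to Charlie in the second round only, when the history of the link has length one.
  · refine ⟨fun _ => {[]}, fun g => if g.length = 1 then {w : Bits | ∃ x s,
        s.length = (Finset.univ.filter fun i => x i = true).card ∧ w = c x ++ s} else {[]},
      fun g => ⟨prefixFree_singleton _, ?_⟩, fun h r hr => ?_⟩
    · dsimp only
      split_ifs
      exacts [prefixFree_code_append hc, prefixFree_singleton _]
    · rcases hcases h r hr with ⟨rfl, y, k, rfl⟩ | ⟨r₀, h', rfl, x, s, hs, rfl⟩
      · simp
      · refine ⟨rfl, ?_⟩
        by_cases hh' : h' = []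
        · subst hh'
          exact ⟨x, s, hs, by simp⟩
        · simp [hh']
  · intro x y _
    simp only [Protocol.Terminates, finalMass_erasureProtocol]
    exact PMF.tsum_coe _

/-- The erasure protocol as a well-formed protocol. -/
noncomputable def erasureWFProtocol (hc : IsPrefixCode c)
    (pXY : PMF ((Fin n → Bool) × (Fin n → Bool))) :
    WFProtocol (Fin n → Bool) (Fin n → Bool) (Fin n → Option Bool) pXY where
  toProtocol := erasureProtocol n c
  wf := wellFormed_erasureProtocol hc pXY

end ErasureProtocol

/-! ### Security from simulators. -/

namespace WFProtocol

theorem isSecure_of_map_eq {X Y Z : Type} {pXY : PMF (X × Y)} (P : WFProtocol X Y Z pXY)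
    (hfull : ∀ s, s ∈ pXY.support) {f : X → Y → Z}
    (hf : ∀ x y m, P.finalMass x y m ≠ 0 → P.out3 m.m23 m.m31 = PMF.pure (f x y))
    (l1 : X → PMF ((Bits × Bits) × (Bits × Bits)))
    (h1 : ∀ s, (P.transcriptLaw hfull s).map (fun m => (m.m12, m.m31)) = l1 s.1)
    (l2 : Y → PMF ((Bits × Bits) × (Bits × Bits)))
    (h2 : ∀ s, (P.transcriptLaw hfull s).map (fun m => (m.m12, m.m23)) = l2 s.2)
    (l3 : Z → PMF ((Bits × Bits) × (Bits × Bits)))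
    (h3 : ∀ s, (P.transcriptLaw hfull s).map (fun m => (m.m23, m.m31)) = l3 (f s.1 s.2)) :
    P.IsSecure fun x y => PMF.pure (f x y) := by
  classical
  refine ⟨fun x y z => ?_, ?_, ?_, ?_⟩
  · have h : (P.law.map fun ω => (inX ω, inY ω, outZ ω)) =
        pXY.map fun s => (s.1, s.2, f s.1 s.2) := by
      conv_rhs => rw [← map_fst_bind_map_mk pXY (P.transcriptLaw hfull), PMF.map_comp]
      rw [P.law_eq_map hfull f hf, jointLaw, PMF.map_comp]
      rfl
    rw [h]
    by_cases hz : z = f x y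
    · subst hz
      rw [PMF.pure_apply_self, mul_one]
      exact map_apply_of_injective pXY (T := fun s : X × Y => (s.1, s.2, f s.1 s.2))
        (fun s s' h => Prod.ext (Prod.mk.inj h).1 (Prod.mk.inj (Prod.mk.inj h).2).1) (x, y)
    · rw [PMF.pure_apply_of_ne _ _ hz, mul_zero, PMF.apply_eq_zero_iff, PMF.mem_support_map_iff]
      rintro ⟨⟨x', y'⟩, -, h⟩
      simp only [Prod.mk.injEq] at h
      obtain ⟨rfl, rfl, rfl⟩ := h
      exact hz rfl
  · rw [P.law_eq_map hfull f hf, markovChain_map_iff, jointLaw]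
    exact markovChain_of_map_eq pXY (P.transcriptLaw hfull) (fun m => (m.m12, m.m31))
      Prod.fst (fun s => (s.2, f s.1 s.2)) l1 h1
  · rw [P.law_eq_map hfull f hf, markovChain_map_iff, jointLaw]
    exact markovChain_of_map_eq pXY (P.transcriptLaw hfull) (fun m => (m.m12, m.m23))
      Prod.snd (fun s => (s.1, f s.1 s.2)) l2 h2
  · rw [P.law_eq_map hfull f hf, markovChain_map_iff, jointLaw]
    exact markovChain_of_map_eq pXY (P.transcriptLaw hfull) (fun m => (m.m23, m.m31))
      (fun s => f s.1 s.2) (fun s => s) l3 h3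

end WFProtocol

/-! ### Security, entropies and lengths of the erasure protocol. -/

section ErasureProtocol

open WFProtocol

variable {n : ℕ} {c : (Fin n → Bool) → Bits} {pXY : PMF ((Fin n → Bool) × (Fin n → Bool))}

theorem transcriptLaw_erasureWFProtocol (hc : IsPrefixCode c) (hfull : ∀ s, s ∈ pXY.support)
    (s : (Fin n → Bool) × (Fin n → Bool)) :
    (erasureWFProtocol hc pXY).transcriptLaw hfull s =
      (PMF.uniformOfFintype (Fin n → Bool)).map (erasureTranscript c s.1 s.2) :=
  PMF.ext fun m => finalMass_erasureProtocol s.1 s.2 m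

theorem out3_erasureWFProtocol (hc : IsPrefixCode c) (x y : Fin n → Bool) (m : Links)
    (hm : (erasureWFProtocol hc pXY).finalMass x y m ≠ 0) :
    (erasureWFProtocol hc pXY).out3 m.m23 m.m31 = PMF.pure (erase x y) := by
  have h : ((PMF.uniformOfFintype (Fin n → Bool)).map (erasureTranscript c x y)) m ≠ 0 := by
    rw [← finalMass_erasureProtocol]
    exact hm
  obtain ⟨k, -, rfl⟩ := (PMF.mem_support_map_iff _ _ _).1 ((PMF.mem_support_iff _ _).2 h)
  exact congrArg PMF.pure (decode_eq_erase hc x y k)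

theorem selectBits_congr {x k k' : Fin n → Bool} (h : ∀ i, x i = true → k i = k' i) :
    selectBits x (List.ofFn k) = selectBits x (List.ofFn k') := by
  rw [selectBits_ofFn, selectBits_ofFn]
  exact List.map_congr_left fun i hi => h i (by simpa using hi)

theorem isSome_erase (x y : Fin n → Bool) : (fun i => (erase x y i).isSome) = x := by
  funext i
  cases h : x i <;> simp [erase, h]

theorem getD_erase {x : Fin n → Bool} (y : Fin n → Bool) {i : Fin n} (hi : x i = true) :
    (erase x y i).getD false = y i := by
  simp [erase, hi]

/-- Alice and Bob see the key and functions of it and their own input. Charlie's view is simulated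
from `z` by drawing Bob's message `w` uniformly: the erasure pattern of `z` gives `x`, and at
selected positions the key must be `w ⊕ z`. -/
theorem isSecure_erasureWFProtocol (hc : IsPrefixCode c) (hfull : ∀ s, s ∈ pXY.support) :
    (erasureWFProtocol hc pXY).IsSecure (controlledErasure n) := by
  refine isSecure_of_map_eq _ hfull (out3_erasureWFProtocol hc)
    (fun x => (PMF.uniformOfFintype (Fin n → Bool)).map fun k =>
      (([], List.ofFn k), ([], c x ++ selectBits x (List.ofFn k)))) (fun s => ?_)
    (fun y => (PMF.uniformOfFintype (Fin n → Bool)).map fun k =>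
      (([], List.ofFn k), (List.ofFn fun i => xor (y i) (k i), []))) (fun s => ?_)
    (fun z => (PMF.uniformOfFintype (Fin n → Bool)).map fun w =>
      ((List.ofFn w, []), ([], c (fun i => (z i).isSome) ++ selectBits (fun i => (z i).isSome)
        (List.ofFn fun i => xor (w i) ((z i).getD false))))) (fun s => ?_)
  · rw [transcriptLaw_erasureWFProtocol, PMF.map_comp]
    rfl
  · rw [transcriptLaw_erasureWFProtocol, PMF.map_comp]
    rfl
  · rw [transcriptLaw_erasureWFProtocol, PMF.map_comp]
    -- The simulator's uniform `w` is realized as `y ⊕ k`.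
    refine Eq.trans ?_ (uniformOfFintype_map_xor s.2 _)
    refine congrArg (fun T => PMF.map T (PMF.uniformOfFintype (Fin n → Bool))) (funext fun k => ?_)
    simp only [Function.comp_apply, erasureTranscript, isSome_erase]
    congr 3
    refine selectBits_congr fun i hi => ?_
    rw [getD_erase _ hi, Bool.xor_comm (s.2 i), Bool.xor_assoc, Bool.xor_self, Bool.xor_false]

theorem entropyOf_M12_erasureWFProtocol (hc : IsPrefixCode c) (hfull : ∀ s, s ∈ pXY.support) :
    entropyOf (erasureWFProtocol hc pXY).law M12 = n := by
  have h : (erasureWFProtocol hc pXY).law.map M12 = _ :=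
    law_map_transcript _ hfull (out3_erasureWFProtocol hc) Links.m12
  rw [entropyOf, h]
  simp only [transcriptLaw_erasureWFProtocol, PMF.map_comp]
  rw [← entropy_uniformOfFintype n, ← entropy_map_injective
    (PMF.uniformOfFintype (Fin n → Bool)) (T := fun k => (([] : Bits), List.ofFn k))
    fun k k' h => List.ofFn_injective (Prod.mk.inj h).2]
  refine congrArg (fun P : PMF (Bits × Bits) => entropy P) (Eq.trans ?_ (PMF.bind_const pXY _))
  rfl

theorem entropyOf_M23_erasureWFProtocol (hc : IsPrefixCode c) (hfull : ∀ s, s ∈ pXY.support) :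
    entropyOf (erasureWFProtocol hc pXY).law M23 = n := by
  have h : (erasureWFProtocol hc pXY).law.map M23 = _ :=
    law_map_transcript _ hfull (out3_erasureWFProtocol hc) Links.m23
  rw [entropyOf, h]
  simp only [transcriptLaw_erasureWFProtocol, PMF.map_comp]
  rw [← entropy_uniformOfFintype n, ← entropy_map_injective
    (PMF.uniformOfFintype (Fin n → Bool)) (T := fun k => (List.ofFn k, ([] : Bits)))
    fun k k' h => List.ofFn_injective (Prod.mk.inj h).1]
  refine congrArg (fun P : PMF (Bits × Bits) => entropy P) (Eq.trans ?_ (PMF.bind_const pXY _))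
  exact congrArg pXY.bind (funext fun s =>
    uniformOfFintype_map_xor s.2 fun w => (List.ofFn w, ([] : Bits)))

/-- `M31` is a function of `erase x k`, with the uniform key in the role of a uniform `y`. The
reverse inequality will come from security. -/
theorem entropyOf_M31_erasureWFProtocol_le (hc : IsPrefixCode c)
    (hfull : ∀ s, s ∈ pXY.support) :
    entropyOf (erasureWFProtocol hc pXY).law M31 ≤ entropy ((pXY.map Prod.fst).bind fun x =>
      (PMF.uniformOfFintype (Fin n → Bool)).map (erase x)) := by
  have h : (erasureWFProtocol hc pXY).law.map M31 = _ :=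
    law_map_transcript _ hfull (out3_erasureWFProtocol hc) Links.m31
  rw [entropyOf, h]
  refine le_trans (le_of_eq (congrArg (fun P : PMF (Bits × Bits) => entropy P) ?_))
    (entropy_map_le _ fun z =>
    (([] : Bits), c (fun i => (z i).isSome) ++ selectBits (fun i => (z i).isSome)
        (List.ofFn fun i => (z i).getD false)))
  rw [PMF.map_bind, PMF.bind_map]
  refine congrArg pXY.bind (funext fun s => ?_)
  rw [transcriptLaw_erasureWFProtocol, PMF.map_comp, Function.comp_apply, PMF.map_comp]
  refine congrArg (fun T => PMF.map T (PMF.uniformOfFintype (Fin n → Bool))) (funext fun k => ?_)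
  simp only [Function.comp_apply, erasureTranscript, isSome_erase]
  congr 2
  exact selectBits_congr fun i hi => (getD_erase k hi).symm

/-- Given the inputs, the key is the only randomness, and the views reveal it through `M12`. -/
theorem randomness_erasureWFProtocol (hc : IsPrefixCode c) (hfull : ∀ s, s ∈ pXY.support) :
    (erasureWFProtocol hc pXY).randomness = n := by
  rw [randomness_eq _ hfull (out3_erasureWFProtocol hc)]
  simp only [transcriptLaw_erasureWFProtocol, PMF.map_comp]
  have h : ∀ s : (Fin n → Bool) × (Fin n → Bool),
      entropy ((PMF.uniformOfFintype (Fin n → Bool)).map ((fun m : Links =>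
        (((m.m12, m.m31), s.1), ((m.m12, m.m23), s.2), ((m.m23, m.m31), erase s.1 s.2))) ∘
          erasureTranscript c s.1 s.2)) = n := by
    intro s
    rw [entropy_map_injective, entropy_uniformOfFintype]
    intro k k' h
    have h12 := congrArg (fun v => v.1.1.1.2) h
    exact List.ofFn_injective h12
  simp only [h]
  rw [ENNReal.tsum_mul_right, pXY.tsum_coe, one_mul]

theorem exists_of_mem_support_law_erasureWFProtocol (hc : IsPrefixCode c)
    {ω : (Fin n → Bool) × (Fin n → Bool) × (Fin n → Option Bool) × Links}
    (hω : ω ∈ (erasureWFProtocol hc pXY).law.support) :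
    ∃ k, ω.2.2.2 = erasureTranscript c ω.1 ω.2.1 k := by
  rw [PMF.mem_support_iff, law_apply] at hω
  have h : ((PMF.uniformOfFintype (Fin n → Bool)).map (erasureTranscript c ω.1 ω.2.1)) ω.2.2.2
      ≠ 0 := by
    rw [← finalMass_erasureProtocol]
    exact right_ne_zero_of_mul (left_ne_zero_of_mul hω)
  obtain ⟨k, -, hk⟩ := (PMF.mem_support_map_iff _ _ _).1 ((PMF.mem_support_iff _ _).2 h)
  exact ⟨k, hk.symm⟩

theorem bitLength_m31_erasureTranscript (x y k : Fin n → Bool) :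
    bitLength (erasureTranscript c x y k).m31 =
      (c x).length + (Finset.univ.filter fun i => x i = true).card := by
  simp [bitLength, erasureTranscript, length_selectBits]

theorem expectation_card_filter {P : PMF (Fin n → Bool)} {p : ℝ}
    (hp : p ∈ Set.Ioo (0 : ℝ) 1) (hP : IsIIDBernoulli P p) :
    expectation P (fun x => (Finset.univ.filter fun i => x i = true).card) =
      ENNReal.ofReal (n * p) := by
  classical
  have hg0 : ∀ b : Bool, 0 ≤ if b then p else 1 - p := by
    rintro (_ | _)
    · simpa using hp.2.le
    · simpa using hp.1.le
  -- Stated for all lengths to allow induction, since `P` is tied to a fixed `n`.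
  have hreal : ∀ n : ℕ, ∑ x : Fin n → Bool, (∏ i, if x i then p else 1 - p) *
      ∑ i, (if x i then (1 : ℝ) else 0) = n * p := by
    intro n
    induction n with
    | zero => simp
    | succ n ih =>
      rw [← (Fin.consEquiv fun _ : Fin (n + 1) => Bool).sum_comp, Fintype.sum_prod_type]
      simp only [Fin.consEquiv, Equiv.coe_fn_mk, Fin.prod_univ_succ, Fin.sum_univ_succ,
        Fin.cons_zero, Fin.cons_succ, Fintype.sum_bool, if_true, Bool.false_eq_true, if_false]
      have h1 := sum_prod_eq_one (fun b : Bool => if b then p else 1 - p) (by simp) n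
      simp only [mul_assoc, mul_add, mul_one, zero_add, Finset.sum_add_distrib,
        ← Finset.mul_sum, ih, h1]
      push_cast
      ring
  rw [expectation, tsum_fintype, ← hreal, ENNReal.ofReal_sum_of_nonneg]
  · refine Finset.sum_congr rfl fun x _ => ?_
    rw [ENNReal.ofReal_mul (Finset.prod_nonneg fun i _ => hg0 _), hP,
      ENNReal.ofReal_prod_of_nonneg fun i _ => hg0 _]
    congr 1
    rw [Finset.card_filter, ← ENNReal.ofReal_natCast]
    push_cast
    rfl
  · intro x _
    exact mul_nonneg (Finset.prod_nonneg fun i _ => hg0 _)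
      (Finset.sum_nonneg fun i _ => by split_ifs <;> simp)

theorem expectation_M31_erasureWFProtocol (hc : IsPrefixCode c)
    (hfull : ∀ s, s ∈ pXY.support) :
    expectation (erasureWFProtocol hc pXY).law (fun ω => bitLength (M31 ω)) =
      expectation (pXY.map Prod.fst) (fun x => (c x).length) +
        expectation (pXY.map Prod.fst)
          (fun x => (Finset.univ.filter fun i => x i = true).card) := by
  have hfst : (erasureWFProtocol hc pXY).law.map inX = pXY.map Prod.fst := by
    rw [law_eq_map _ hfull _ (out3_erasureWFProtocol hc), PMF.map_comp]
    conv_rhs => rw [← map_fst_bind_map_mk pXY ((erasureWFProtocol hc pXY).transcriptLaw hfull),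
      PMF.map_comp]
    rfl
  rw [← hfst, expectation, expectation, expectation, tsum_map_mul, tsum_map_mul,
    ← ENNReal.tsum_add]
  refine tsum_congr fun ω => ?_
  by_cases hω : ω ∈ (erasureWFProtocol hc pXY).law.support
  · obtain ⟨k, hk⟩ := exists_of_mem_support_law_erasureWFProtocol hc hω
    have hlen : bitLength (M31 ω) =
        (c (inX ω)).length + (Finset.univ.filter fun i => inX ω i = true).card := by
      rw [M31, hk, bitLength_m31_erasureTranscript]
      rfl
    rw [hlen, ← mul_add]
    push_cast
    rfl
  · rw [(PMF.apply_eq_zero_iff _ _).2 hω]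
    simp

end ErasureProtocol

end SecureComp
-- The main theorem.
theorem mainTheorem9 (n : ℕ) (p q : ℝ) (hp : p ∈ Set.Ioo (0 : ℝ) 1) (hq : q ∈ Set.Ioo (0 : ℝ) 1)
    (pXY : PMF ((Fin n → Bool) × (Fin n → Bool))) (hfull : ∀ x y, 0 < pXY (x, y))
    (hX : IsIIDBernoulli (pXY.map Prod.fst) p) (hY : IsIIDBernoulli (pXY.map Prod.snd) q) :
    -- lower bounds on the transcripts of every secure protocol: entropy, expected number of bits
    (∀ P : WFProtocol (Fin n → Bool) (Fin n → Bool) (Fin n → Option Bool) pXY,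
      P.IsSecure (controlledErasure n) →
        (ENNReal.ofReal (n * (binaryEntropy p + p)) ≤ entropyOf P.law M31 ∧
          (n : ℝ≥0∞) ≤ entropyOf P.law M12 ∧
          (n : ℝ≥0∞) ≤ entropyOf P.law M23) ∧
        (ENNReal.ofReal (n * (binaryEntropy p + p)) ≤
            expectation P.law (fun ω => bitLength (M31 ω)) ∧
          (n : ℝ≥0∞) ≤ expectation P.law (fun ω => bitLength (M12 ω)) ∧
          (n : ℝ≥0∞) ≤ expectation P.law (fun ω => bitLength (M23 ω)))) ∧
    -- lower bound on the randomness
    (n : ℝ≥0∞) ≤ randomnessRequired pXY (controlledErasure n) ∧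
    -- the protocol attains the bounds
    (∃ c, IsOptimalPrefixCode (pXY.map Prod.fst) c) ∧
    (∀ c, IsOptimalPrefixCode (pXY.map Prod.fst) c →
      ∃ P : WFProtocol (Fin n → Bool) (Fin n → Bool) (Fin n → Option Bool) pXY,
        P.toProtocol = erasureProtocol n c ∧
        P.IsCommunicationIdeal (controlledErasure n) ∧
        P.IsRandomnessOptimal (controlledErasure n) ∧
        entropyOf P.law M31 = ENNReal.ofReal (n * (binaryEntropy p + p)) ∧
        entropyOf P.law M12 = n ∧
        entropyOf P.law M23 = n ∧
        P.randomness = n ∧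
        (∀ ω ∈ P.law.support, bitLength (M12 ω) = n ∧ bitLength (M23 ω) = n) ∧
        expectation P.law (fun ω => bitLength (M31 ω)) <
          ENNReal.ofReal (n * (binaryEntropy p + p) + 1)) := by
  have hfull' : ∀ s, s ∈ pXY.support := fun s => (hfull s.1 s.2).ne'
  -- The all-zero string hides `y` entirely and the all-one string reveals it: these serve as `x₀`
  -- and `x₁` in the lower bounds.
  have hx₀ := erase_false (n := n)
  have hx₁ := erase_true_injective n
  have hXne : ∀ x, (pXY.map Prod.fst) x ≠ 0 := fun x h0 =>
    hfull' (x, x) (le_antisymm ((le_map_apply pXY Prod.fst (x, x)).trans h0.le) zero_le)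
  have hb : 0 ≤ binaryEntropy p :=
    div_nonneg (Real.binEntropy_nonneg hp.1.le hp.2.le) (Real.log_pos one_lt_two).le
  have lower : ∀ P : WFProtocol (Fin n → Bool) (Fin n → Bool) (Fin n → Option Bool) pXY,
      P.IsSecure (controlledErasure n) →
        ENNReal.ofReal (n * (binaryEntropy p + p)) ≤ entropyOf P.law M31 ∧
          (n : ℝ≥0∞) ≤ entropyOf P.law M12 ∧ (n : ℝ≥0∞) ≤ entropyOf P.law M23 := by
    intro P hP
    refine ⟨?_, ?_, ?_⟩
    · rw [← entropy_bind_map_erase hp hX]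
      exact hP.entropyOf_M31_ge hfull' hx₀ _
    · rw [← entropy_uniformOfFintype]
      exact hP.entropyOf_M12_ge hfull' hx₀ hx₁ _
    · rw [← entropy_uniformOfFintype]
      exact hP.entropyOf_M23_ge hfull' hx₀ hx₁ _
  have lowerRand : (n : ℝ≥0∞) ≤ randomnessRequired pXY (controlledErasure n) := by
    refine le_iInf₂ fun P hP => ?_
    rw [← entropy_uniformOfFintype]
    exact IsSecure.randomness_ge hfull' hP hx₀ hx₁ _
  refine ⟨fun P hP => ⟨lower P hP, ?_, ?_, ?_⟩, lowerRand,
    exists_isOptimalPrefixCode _ hXne, fun c hc => ?_⟩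
  · exact (lower P hP).1.trans
      (P.entropyOf_le_expectation_bitLength P.wf.coded31 Protocol.concat_m31)
  · exact (lower P hP).2.1.trans
      (P.entropyOf_le_expectation_bitLength P.wf.coded12 Protocol.concat_m12)
  · exact (lower P hP).2.2.trans
      (P.entropyOf_le_expectation_bitLength P.wf.coded23 Protocol.concat_m23)
  · have hsec := isSecure_erasureWFProtocol hc.1 hfull'
    have h31 : entropyOf (erasureWFProtocol hc.1 pXY).law M31 =
        ENNReal.ofReal (n * (binaryEntropy p + p)) := by
      refine le_antisymm ?_ (lower _ hsec).1
      rw [← entropy_bind_map_erase hp hX]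
      exact entropyOf_M31_erasureWFProtocol_le hc.1 hfull'
    have h12 := entropyOf_M12_erasureWFProtocol hc.1 hfull'
    have h23 := entropyOf_M23_erasureWFProtocol hc.1 hfull'
    have hrand := randomness_erasureWFProtocol hc.1 hfull'
    refine ⟨erasureWFProtocol hc.1 pXY, rfl, ⟨hsec, ?_, ?_, ?_⟩, ⟨hsec, ?_⟩, h31, h12, h23, hrand,
      fun ω hω => ?_, ?_⟩
    · exact le_antisymm (le_iInf₂ fun Q hQ => h12.trans_le (lower Q hQ).2.1)
        (iInf₂_le (erasureWFProtocol hc.1 pXY) hsec)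
    · exact le_antisymm (le_iInf₂ fun Q hQ => h23.trans_le (lower Q hQ).2.2)
        (iInf₂_le (erasureWFProtocol hc.1 pXY) hsec)
    · exact le_antisymm (le_iInf₂ fun Q hQ => h31.trans_le (lower Q hQ).1)
        (iInf₂_le (erasureWFProtocol hc.1 pXY) hsec)
    · exact le_antisymm (hrand.trans_le lowerRand)
        (iInf₂_le (erasureWFProtocol hc.1 pXY) hsec)
    · obtain ⟨k, hk⟩ := exists_of_mem_support_law_erasureWFProtocol hc.1 hω
      rw [M12, M23, hk]
      simp [erasureTranscript, bitLength]
    · have hlt := hc.expectation_lt hXne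
      rw [entropy_of_isIIDBernoulli hp hX] at hlt
      rw [expectation_M31_erasureWFProtocol hc.1 hfull', expectation_card_filter hp hX]
      refine (ENNReal.add_lt_add_right ENNReal.ofReal_ne_top hlt).trans_eq ?_
      rw [← ENNReal.ofReal_one, ← ENNReal.ofReal_add (by positivity) zero_le_one,
        ← ENNReal.ofReal_add (by positivity) (mul_nonneg (Nat.cast_nonneg n) hp.1.le)]
      congr 1
      ring
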